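/- **Theorem (Foliation Theorem).** Let $P:\mathbb{R}^N\to\mathbb{R}^N$ be a locally Lipschitz vector field and consider $\dot{x}=P(x)$. *Terminology.* A *simple orbit* is the image $\mathcal X=x([0,T])$, $T>0$, of a solution $x:[0,T]\to\mathbb{R}^N$ that is injective and passes through no zero of $P$. An *orbit in a set* $A$ is a solution $\gamma:[a,b]\to\mathbb{R}^N$ with $\gamma([a,b])\subseteq A$, for any $a,b$. An *invariant submanifold* is a nonempty injectively immersed $C^1$ submanifold $S\subseteq\mathbb{R}^N$ without boundary, of any dimension, such that every solution that meets $S$ stays in $S$ for all times at which it is defined. A *regular neighborhood* of $\mathcal X$ (adapted to the foliation by orbits) is a set $\mathcal N\subset\mathbb{R}^N$ with $\mathcal X$ in its interior that is the closed cube $[-1,1]^N=[-1,1]\times[-1,1]^{N-1}$ in some $C^1$ coordinates $u$ defined on an open set containing $\mathcal N$, such that one coordinate $u_k$ satisfies $du_k(P)>0$ on the two end discs $u_k=\pm1$, while $P$ is tangent to the lateral faces: $du_j(P)=0$ on $u_j=\pm1$ for all $j\neq k$. A *monotone representation* of the dynamic on $A$ is a coordinate system of $\mathbb{R}^N$, i.e.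 a homeomorphism $\varphi:\mathbb{R}^N\to\mathbb{R}^N$, each of whose coordinates $\varphi_i$ is either strictly increasing along all orbits in $A$ or strictly decreasing along all orbits in $A$. 1. Let $\mathcal N$ be a regular neighborhood of a simple orbit, and suppose that $\mathcal N$ contains no invariant submanifold. Then there is a monotone representation $\varphi$ of the dynamic on $\mathcal N$ (one $\varphi$ for all orbits in $\mathcal N$ simultaneously), and $\varphi$ can be taken ambient isotopic to the identity: there is a continuous $H:\mathbb{R}^N\times[0,1]\to\mathbb{R}^N$, each $H_t$ a homeomorphism of $\mathbb{R}^N$, with $H_0=\mathrm{id}$ and $H_1=\varphi$. 2. Let $\mathcal N_1,\mathcal N_2$ be two such neighborhoods (of two simple orbits) with $\mathcal N_1\cap\mathcal N_2\neq\emptyset$. For all monotone representations $\varphi_1$ on $\mathcal N_1$ and $\varphi_2$ on $\mathcal N_2$ there is a homeomorphism $\Psi$ of $\mathbb{R}^N$ with $\Psi\circ\varphi_1=\varphi_2$ on $\mathcal N_1\cap\mathcal N_2$ which preserves monotonicity: for every orbit $\gamma$ in $\mathcal N_1\cap\mathcal N_2$ and every $i$, if the $i$-th entry of $\varphi_1\circ\gamma$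 is strictly monotone, then so is the $i$-th entry of $\Psi\circ\varphi_1\circ\gamma$. Moreover, $\varphi_1$, $\varphi_2$ (each ambient isotopic to the identity) and $\Psi$ can be chosen so that $\Psi$ also preserves the sense of monotonicity: for every orbit $\gamma$ in $\mathcal N_1\cap\mathcal N_2$, entries of $\varphi_1\circ\gamma$ that are strictly increasing (decreasing) remain strictly increasing (decreasing) after applying $\Psi$. -/

import Mathlib

open Set
open scoped Manifold ContDiff Topology

namespace Foliation

/-- Euclidean `n`-space, the phase space of the dynamic. -/
abbrev Space (n : ℕ) : Type := EuclideanSpace ℝ (Fin n)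

variable {n : ℕ}

/-- `γ` solves the autonomous equation `γ' = P ∘ γ` on the set of times `s`
(one-sided derivatives at the ends of an interval). -/
def IsSolutionOn (P : Space n → Space n) (γ : ℝ → Space n) (s : Set ℝ) : Prop :=
  IsIntegralCurveOn γ (fun _ => P) s

/-- The restriction of `γ` to `[0, T]` is a simple orbit curve of `P`: a solution without
self-intersections and without equilibrium points. -/
structure IsSimpleOrbit (P : Space n → Space n) (T : ℝ) (γ : ℝ → Space n) : Prop where
  pos : 0 < T
  solution : IsSolutionOn P γ (Icc 0 T)
  injOn : InjOn γ (Icc 0 T)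
  ne_equilibrium : ∀ t ∈ Icc 0 T, P (γ t) ≠ 0

/-- `γ` restricted to `[a, b]` is an orbit curve of `P` that is contained in `A`. -/
def IsOrbitIn (P : Space n → Space n) (A : Set (Space n)) (a b : ℝ) (γ : ℝ → Space n) : Prop :=
  IsSolutionOn P γ (Icc a b) ∧ MapsTo γ (Icc a b) A

/-- `S` is invariant: a solution, on any interval of times, that meets `S` stays in `S`. -/
def IsInvariantUnder (P : Space n → Space n) (S : Set (Space n)) : Prop :=
  ∀ (γ : ℝ → Space n) (s : Set ℝ), s.OrdConnected → IsSolutionOn P γ s →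
    (∃ t ∈ s, γ t ∈ S) → MapsTo γ s S

/-- `S` is a (nonempty, immersed) `C^1` submanifold of dimension `k`, without boundary: the image
of a `k`-manifold under an injective `C^1` immersion. -/
def IsImmersedSubmanifold (k : ℕ) (S : Set (Space n)) : Prop :=
  ∃ (M : Type) (_ : TopologicalSpace M) (_ : ChartedSpace (Space k) M)
    (_ : IsManifold (𝓡 k) 1 M) (_ : T2Space M) (_ : SecondCountableTopology M) (_ : Nonempty M)
    (f : M → Space n),
    ContMDiff (𝓡 k) (𝓡 n) 1 f ∧ Function.Injective f ∧
      (∀ x, Function.Injective (mfderiv (𝓡 k) (𝓡 n) f x)) ∧ range f = S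

/-- `S` is an invariant submanifold of the dynamic, of some dimension. Equilibria, periodic orbits,
other complete orbits, and stable and unstable manifolds are examples. -/
def IsInvariantSubmanifold (P : Space n → Space n) (S : Set (Space n)) : Prop :=
  (∃ k, IsImmersedSubmanifold k S) ∧ IsInvariantUnder P S

/-- The standard closed cube `[-1, 1]^n`. -/
def cube (n : ℕ) : Set (Space n) := {u | ∀ i, |u i| ≤ 1}

/-- In the `C^1` coordinates `e`, the set `N` is the cube `[-1, 1]^n`, regarded as the tube
`[-1, 1] × [-1, 1]^(n-1)` whose first factor is the coordinate `k`. The vector field crosses the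
two ends of the tube transversally, from the bottom `-1` to the top `1` (so it points inwards at
the bottom and outwards at the top), and it is tangent to the lateral faces.
Here `fderiv ℝ e x (P x)` is the vector `P x` expressed in the coordinates `e`. -/
structure IsFlowTube (P : Space n → Space n) (N : Set (Space n))
    (e : OpenPartialHomeomorph (Space n) (Space n)) (k : Fin n) : Prop where
  contDiffOn : ContDiffOn ℝ 1 e e.source
  contDiffOn_symm : ContDiffOn ℝ 1 e.symm e.target
  cube_subset : cube n ⊆ e.target
  eq_image : N = e.symm '' cube n
  transverse_ends : ∀ x ∈ N, |e x k| = 1 → 0 < (fderiv ℝ e x (P x)) k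
  tangent_sides : ∀ x ∈ N, ∀ j, j ≠ k → |e x j| = 1 → (fderiv ℝ e x (P x)) j = 0

/-- `N` is a regular neighborhood of the curve `C`, adapted to the foliation by orbits: a tube
around `C` whose lateral boundary is tangent to the orbits and whose two end discs are
transverse to them. -/
def IsRegularNeighborhood (P : Space n → Space n) (N C : Set (Space n)) : Prop :=
  C ⊆ interior N ∧ ∃ e k, IsFlowTube P N e k

/-- `N` is a regular neighborhood of some simple orbit curve, and `N` contains no invariant
submanifold. -/
def IsAdmissible (P : Space n → Space n) (N : Set (Space n)) (T : ℝ) (γ : ℝ → Space n) : Prop :=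
  IsSimpleOrbit P T γ ∧ IsRegularNeighborhood P N (γ '' Icc 0 T) ∧
    ∀ S, IsInvariantSubmanifold P S → ¬ S ⊆ N

/-- `φ` is the final map of an ambient isotopy of Euclidean space. -/
def IsFinalMapOfIsotopy (φ : Space n → Space n) : Prop :=
  ∃ H : Space n × unitInterval → Space n, Continuous H ∧
    (∀ t, IsHomeomorph fun x => H (x, t)) ∧ (∀ x, H (x, 0) = x) ∧ ∀ x, H (x, 1) = φ x

/-- The coordinate system `φ` is a monotone representation of the dynamic on `A`: every coordinate
is strictly increasing along all orbit curves in `A`, or strictly decreasing along all of them. -/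
structure IsMonotoneRepresentation (P : Space n → Space n) (A : Set (Space n))
    (φ : Space n → Space n) : Prop where
  isHomeomorph : IsHomeomorph φ
  monotone : ∀ i,
    (∀ a b γ, IsOrbitIn P A a b γ → StrictMonoOn (fun t => φ (γ t) i) (Icc a b)) ∨
    (∀ a b γ, IsOrbitIn P A a b γ → StrictAntiOn (fun t => φ (γ t) i) (Icc a b))

/-- `Ψ` is a transition map over `A` from the coordinates `φ₁` to the coordinates `φ₂`. -/
def IsTransition (A : Set (Space n)) (φ₁ φ₂ Ψ : Space n → Space n) : Prop :=
  IsHomeomorph Ψ ∧ ∀ x ∈ A, Ψ (φ₁ x) = φ₂ x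

/-- `Ψ` preserves monotonicity: it sends the orbit curves in `A`, written in the coordinates `φ`,
to curves that are again strictly monotone in each entry. -/
def PreservesMonotonicity (P : Space n → Space n) (A : Set (Space n))
    (φ Ψ : Space n → Space n) : Prop :=
  ∀ a b γ, IsOrbitIn P A a b γ → ∀ i,
    (StrictMonoOn (fun t => φ (γ t) i) (Icc a b) ∨ StrictAntiOn (fun t => φ (γ t) i) (Icc a b)) →
    (StrictMonoOn (fun t => Ψ (φ (γ t)) i) (Icc a b) ∨
      StrictAntiOn (fun t => Ψ (φ (γ t)) i) (Icc a b))

/-- `Ψ` preserves monotonicity together with its sense: entries that increase along an orbit curve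
in `A` still increase after `Ψ`, and entries that decrease still decrease. -/
def PreservesSense (P : Space n → Space n) (A : Set (Space n))
    (φ Ψ : Space n → Space n) : Prop :=
  ∀ a b γ, IsOrbitIn P A a b γ → ∀ i,
    (StrictMonoOn (fun t => φ (γ t) i) (Icc a b) →
      StrictMonoOn (fun t => Ψ (φ (γ t)) i) (Icc a b)) ∧
    (StrictAntiOn (fun t => φ (γ t) i) (Icc a b) →
      StrictAntiOn (fun t => Ψ (φ (γ t)) i) (Icc a b))

end Foliation

/-! In dimension at least two every coordinate can be made to increase. Near the bottom disc u_k =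
-1 of the tube the orbits rise at a definite rate, by transversality and compactness, so there a
large multiple of u_k, added to all coordinates, beats any other linear term. It remains to slide
the whole tube along its orbits into this low layer. The flow of -χP does so, where χ vanishes on
the bottom disc and is positive on the rest of the tube: it only reparametrizes orbits, and by
Nagumo's theorem the boundary conditions make the tube forward invariant. If no finite time
sufficed, compactness would give a point whose flow line stays above the layer in past and future.
There χ is bounded below, so this line is a complete orbit of P in the tube: an equilibrium, a
circle or an injectively immersed line, all of which are excluded (`exists_time`,
`isInvariantSubmanifold_range`).

Everything must be ambient isotopic to the identity. A flow is. The inverse chart is made linear on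
the cube by shrinking the cube radially and straightening near its centre (`exists_isotopy_chart`);
orientation is no obstruction, since any invertible linear map will do. Adding C u_k p is a rank-one
change that stays invertible along the path if a sign is right; a half turn in a coordinate plane
arranges the sign, and this uses dimension two (`exists_isotopy_shear`). In dimension one P has no
zero on the connected tube, so the identity is monotone.

Transition maps are φ₂ ∘ φ₁⁻¹. The sense is preserved if both representations increase, or, in
dimension one, if both are the identity. -/

namespace Foliation

open Metric Filter
open scoped NNReal

/-! ### Global flows, time changes and forward invariance -/

section Flow

variable {E : Type*} [NormedAddCommGroup E] [NormedSpace ℝ E]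

/-- `Φ` is a global flow of the vector field `V`. -/
structure IsFlow (V : E → E) (Φ : ℝ → E → E) : Prop where
  zero : ∀ x, Φ 0 x = x
  hasDerivAt : ∀ x t, HasDerivAt (fun s => Φ s x) (V (Φ t x)) t

/-- A bounded Lipschitz vector field has a global flow. -/
theorem exists_isFlow [CompleteSpace E] {V : E → E} {K : ℝ≥0} (hV : LipschitzWith K V)
    {M : ℝ≥0} (hM : ∀ x, ‖V x‖ ≤ M) : ∃ Φ, IsFlow V Φ := by
  have key : ∀ (x : E) (m : ℕ), ∃ α : ℝ → E, α 0 = x ∧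
      ∀ t ∈ Icc (-(m : ℝ)) m, HasDerivWithinAt α (V (α t)) (Icc (-(m : ℝ)) m) t := by
    intro x m
    -- In time `m` a solution moves at most `M * m`, so a ball of this radius meets the
    -- Picard–Lindelöf condition on all of [-m, m].
    have hpl : IsPicardLindelof (fun _ : ℝ => V)
        (⟨0, by simp⟩ : Icc (-(m : ℝ)) m) x (M * m) 0 M K :=
      { lipschitzOnWith := fun t _ => hV.lipschitzOnWith
        continuousOn := fun x _ => continuousOn_const
        norm_le := fun t _ x _ => hM x
        mul_max_le := by simp }
    exact hpl.exists_eq_forall_mem_Icc_hasDerivWithinAt₀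
  choose α hα0 hα using key
  have hd : ∀ x (m : ℕ), ∀ t ∈ Ioo (-(m : ℝ)) m, HasDerivAt (α x m) (V (α x m t)) t :=
    fun x m t ht => (hα x m t (Ioo_subset_Icc_self ht)).hasDerivAt (Icc_mem_nhds ht.1 ht.2)
  have huniq : ∀ x (m m' : ℕ) (t : ℝ), |t| < m → |t| < m' → α x m t = α x m' t := by
    intro x m m' t hm hm'
    have hsub : ∀ s ∈ Ioo (-(min (m : ℝ) m')) (min (m : ℝ) m'),
        s ∈ Ioo (-(m : ℝ)) m ∧ s ∈ Ioo (-(m' : ℝ)) m' := by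
      intro s hs
      have := abs_lt.2 hs
      exact ⟨abs_lt.1 (this.trans_le (min_le_left _ _)), abs_lt.1 (this.trans_le (min_le_right _ _))⟩
    have hpos : 0 < min (m : ℝ) m' :=
      lt_min ((abs_nonneg t).trans_lt hm) ((abs_nonneg t).trans_lt hm')
    exact ODE_solution_unique_of_mem_Ioo (v := fun _ => V) (s := fun _ => univ) (t₀ := 0)
      (fun _ _ => hV.lipschitzOnWith) ⟨by linarith, hpos⟩
      (fun s hs => ⟨hd x m s (hsub s hs).1, mem_univ _⟩)
      (fun s hs => ⟨hd x m' s (hsub s hs).2, mem_univ _⟩)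
      (by rw [hα0, hα0]) (abs_lt.1 (lt_min hm hm'))
  -- The index exceeds |t| strictly, so `t` is interior to the interval of the chosen solution and
  -- the derivative is two-sided.
  refine ⟨fun t x => α x (⌊|t|⌋₊ + 1) t, fun x => hα0 _ _, fun x t => ?_⟩
  have h1 : |t| < (⌊|t|⌋₊ + 1 : ℕ) := by exact_mod_cast Nat.lt_floor_add_one |t|
  have h2 := hd x (⌊|t|⌋₊ + 1) t (abs_lt.1 h1)
  refine h2.congr_of_eventuallyEq ?_
  have : ∀ᶠ s : ℝ in 𝓝 t, |s| < (⌊|t|⌋₊ + 1 : ℕ) :=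
    continuous_abs.continuousAt.eventually (gt_mem_nhds h1)
  filter_upwards [this] with s hs
  exact huniq x _ _ s (by exact_mod_cast Nat.lt_floor_add_one |s|) hs

namespace IsFlow

variable {V : E → E} {Φ : ℝ → E → E} {K : ℝ≥0}

theorem continuous_time (hΦ : IsFlow V Φ) (x : E) : Continuous fun t => Φ t x :=
  continuous_iff_continuousAt.2 fun t => (hΦ.hasDerivAt x t).continuousAt

/-- A solution of a scalar multiple of the equation is a reparametrization of the flow. -/
theorem eq_reparam (hΦ : IsFlow V Φ) (hV : LipschitzWith K V) {a b : ℝ} {y : ℝ → E}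
    {g G : ℝ → ℝ} {C : ℝ≥0} (hC : ∀ t ∈ Icc a b, ‖g t‖ ≤ C)
    (hG : ∀ t ∈ Icc a b, HasDerivWithinAt G (g t) (Icc a b) t) (hGa : G a = 0)
    (hy : ∀ t ∈ Icc a b, HasDerivWithinAt y (g t • V (y t)) (Icc a b) t) :
    ∀ t ∈ Icc a b, y t = Φ (G t) (y a) := by
  have hz : ∀ t ∈ Icc a b, HasDerivWithinAt (fun t => Φ (G t) (y a))
      (g t • V (Φ (G t) (y a))) (Icc a b) t := fun t ht =>
    (hΦ.hasDerivAt (y a) (G t)).scomp_hasDerivWithinAt t (hG t ht)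
  have hnhds : ∀ t ∈ Ico a b, Icc a b ∈ 𝓝[≥] t := fun t ht =>
    mem_of_superset (Icc_mem_nhdsGE ht.2) (Icc_subset_Icc_left ht.1)
  intro t ht
  -- Both curves solve the time-dependent equation with field g(t)V, which is Lipschitz with
  -- constant `C * K` uniformly in time.
  refine ODE_solution_unique_of_mem_Icc_right (v := fun t x => g t • V x) (s := fun _ => univ)
    (K := C * K) (fun t ht => ?_) (fun t ht => (hy t ht).continuousWithinAt)
    (fun t ht => (hy t (Ico_subset_Icc_self ht)).mono_of_mem_nhdsWithin (hnhds t ht))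
    (fun _ _ => mem_univ _) (fun t ht => (hz t ht).continuousWithinAt)
    (fun t ht => (hz t (Ico_subset_Icc_self ht)).mono_of_mem_nhdsWithin (hnhds t ht))
    (fun _ _ => mem_univ _) (by simp [hGa, hΦ.zero]) ht
  refine LipschitzWith.lipschitzOnWith (LipschitzWith.of_dist_le_mul fun x x' => ?_)
  rw [dist_smul₀, NNReal.coe_mul, mul_assoc]
  exact mul_le_mul (hC t (Ico_subset_Icc_self ht)) (hV.dist_le_mul x x') dist_nonneg C.2

theorem neg (hΦ : IsFlow V Φ) : IsFlow (fun x => -V x) fun t => Φ (-t) where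
  zero x := by simp [hΦ.zero]
  hasDerivAt x t := by
    have := (hΦ.hasDerivAt x (-t)).scomp t (hasDerivAt_neg t)
    simpa [Function.comp_def] using this

theorem shift (hΦ : IsFlow V Φ) (x : E) (s t : ℝ) :
    HasDerivAt (fun r => Φ (r + s) x) (V (Φ (t + s) x)) t := by
  simpa using (hΦ.hasDerivAt x (t + s)).comp_add_const t s

theorem add (hΦ : IsFlow V Φ) (hV : LipschitzWith K V) (s t : ℝ) (x : E) :
    Φ (s + t) x = Φ s (Φ t x) := by
  have := ODE_solution_unique_univ (v := fun _ => V) (s := fun _ => univ) (t₀ := 0)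
    (f := fun r => Φ (r + t) x) (g := fun r => Φ r (Φ t x))
    (fun _ => hV.lipschitzOnWith) (fun r => ⟨hΦ.shift x t r, mem_univ _⟩)
    (fun r => ⟨hΦ.hasDerivAt _ r, mem_univ _⟩) (by simp [hΦ.zero])
  exact congrFun this s

theorem apply_neg (hΦ : IsFlow V Φ) (hV : LipschitzWith K V) (t : ℝ) (x : E) :
    Φ (-t) (Φ t x) = x := by
  rw [← hΦ.add hV, neg_add_cancel, hΦ.zero]

theorem dist_le_of_nonneg (hΦ : IsFlow V Φ) (hV : LipschitzWith K V) {t : ℝ} (ht : 0 ≤ t)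
    (x y : E) : dist (Φ t x) (Φ t y) ≤ dist x y * Real.exp (K * t) := by
  have := dist_le_of_trajectories_ODE (v := fun _ => V) (a := 0) (b := t) (δ := dist x y)
    (f := fun r => Φ r x) (g := fun r => Φ r y)
    (fun _ => hV) (hΦ.continuous_time x).continuousOn
    (fun r _ => (hΦ.hasDerivAt x r).hasDerivWithinAt) (hΦ.continuous_time y).continuousOn
    (fun r _ => (hΦ.hasDerivAt y r).hasDerivWithinAt) (by simp [hΦ.zero]) t ⟨ht, le_rfl⟩
  simpa using this

theorem dist_le (hΦ : IsFlow V Φ) (hV : LipschitzWith K V) (t : ℝ)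
    (x y : E) : dist (Φ t x) (Φ t y) ≤ dist x y * Real.exp (K * |t|) := by
  rcases le_total 0 t with ht | ht
  · rw [abs_of_nonneg ht]
    exact hΦ.dist_le_of_nonneg hV ht x y
  · have hV' : LipschitzWith K fun x => -V x := hV.neg
    simpa [abs_of_nonpos ht] using hΦ.neg.dist_le_of_nonneg hV' (neg_nonneg.2 ht) x y

theorem continuous_uncurry (hΦ : IsFlow V Φ) (hV : LipschitzWith K V) :
    Continuous fun p : ℝ × E => Φ p.1 p.2 := by
  refine continuous_iff_continuousAt.2 fun ⟨t, x⟩ => ?_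
  rw [ContinuousAt, tendsto_iff_dist_tendsto_zero]
  have h1 : Continuous fun p : ℝ × E =>
      dist p.2 x * Real.exp (K * |p.1|) + dist (Φ p.1 x) (Φ t x) := by
    have := hΦ.continuous_time x
    fun_prop
  have h2 := h1.tendsto (t, x)
  simp only [dist_self, zero_mul, add_zero] at h2
  exact squeeze_zero (fun _ => dist_nonneg)
    (fun p => (dist_triangle _ (Φ p.1 x) _).trans (by gcongr; exact hΦ.dist_le hV _ _ _)) h2

theorem isHomeomorph (hΦ : IsFlow V Φ) (hV : LipschitzWith K V) (t : ℝ) : IsHomeomorph (Φ t) := by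
  have hc : ∀ s, Continuous (Φ s) := fun s =>
    (hΦ.continuous_uncurry hV).comp (by fun_prop : Continuous fun x : E => (s, x))
  refine isHomeomorph_iff_exists_inverse.2 ⟨hc t, Φ (-t), hΦ.apply_neg hV t, fun x => ?_, hc _⟩
  simpa using hΦ.apply_neg hV (-t) x

end IsFlow

/-- Nagumo's theorem: a closed set is forward invariant if at each of its points the vector field
is the velocity of a curve that starts there and stays in the set for a while. -/
theorem IsFlow.mapsTo_of_subtangential [ProperSpace E] {V : E → E} {Φ : ℝ → E → E} {K : ℝ≥0}
    (hΦ : IsFlow V Φ) (hV : LipschitzWith K V) {A : Set E} (hA : IsClosed A)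
    (htan : ∀ y ∈ A, ∃ c : ℝ → E, c 0 = y ∧ HasDerivWithinAt c (V y) (Ici 0) 0 ∧
      ∀ᶠ r in 𝓝[>] (0 : ℝ), c r ∈ A) {x : E} (hx : x ∈ A) {t : ℝ} (ht : 0 ≤ t) : Φ t x ∈ A := by
  have hne : A.Nonempty := ⟨x, hx⟩
  rw [hA.mem_iff_infDist_zero hne]
  refine le_antisymm ?_ infDist_nonneg
  -- The distance f from the flow line to `A` has lower right derivative at most K f and starts at
  -- 0, so Grönwall gives f = 0.
  have := le_gronwallBound_of_liminf_deriv_right_le (f := fun s => infDist (Φ s x) A)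
    (f' := fun s => K * infDist (Φ s x) A) (δ := 0) (K := K) (ε := 0) (a := 0) (b := t)
    ((continuous_infDist_pt A).comp (hΦ.continuous_time x)).continuousOn ?_
    (by simp [hΦ.zero, infDist_zero_of_mem hx]) (by simp) t ⟨ht, le_rfl⟩
  · simpa [gronwallBound_ε0_δ0] using this
  intro s _ r hr
  -- The flow line is compared with the curve in `A` that leaves the nearest point `y`. Their
  -- distance bounds f, with equality at time `s`, and their velocities differ by at most K f(s).
  obtain ⟨y, hyA, hy⟩ := hA.exists_infDist_eq_dist hne (Φ s x)
  obtain ⟨c, hc0, hc, hcA⟩ := htan y hyA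
  have hc' : HasDerivWithinAt (fun z => c (z - s)) (V y) (Ici s) s := by
    have h1 : HasDerivWithinAt c (V y) (Ici 0) (s - s) := by simpa using hc
    have := h1.scomp (h := fun z => z - s) s
      ((hasDerivAt_id s).sub_const s).hasDerivWithinAt
      (fun z (hz : s ≤ z) => sub_nonneg.2 hz)
    simpa using! this
  have hD := ((hΦ.hasDerivAt x s).hasDerivWithinAt (s := Ici s)).sub hc'
  have hr' : ‖V (Φ s x) - V y‖ < r := by
    refine lt_of_le_of_lt ?_ hr
    rw [← dist_eq_norm, hy]
    exact hV.dist_le_mul _ _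
  have hev : ∀ᶠ z in 𝓝[>] s, c (z - s) ∈ A := by
    have : Tendsto (fun z => z - s) (𝓝[>] s) (𝓝[>] 0) := by
      refine tendsto_nhdsWithin_iff.2 ⟨?_, ?_⟩
      · have : Continuous fun z : ℝ => z - s := by fun_prop
        simpa using (this.tendsto s).mono_left nhdsWithin_le_nhds
      · filter_upwards [self_mem_nhdsWithin] with z hz
        simpa using hz
    exact this.eventually hcA
  refine ((hD.liminf_right_slope_norm_le hr').and_eventually
    (hev.and self_mem_nhdsWithin)).mono ?_
  rintro z ⟨h1, h2, h3⟩
  refine lt_of_le_of_lt ?_ h1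
  have h3' : 0 < z - s := sub_pos.2 h3
  have h4 : infDist (Φ z x) A ≤ ‖Φ z x - c (z - s)‖ := by
    rw [← dist_eq_norm]; exact infDist_le_dist_of_mem h2
  have h5 : infDist (Φ s x) A = ‖Φ s x - c (s - s)‖ := by
    rw [← dist_eq_norm, sub_self, hc0]; exact hy
  simp only [Pi.sub_apply]
  rw [h5]
  gcongr

end Flow

/-! ### Uniqueness of solutions, and complete orbits as submanifolds -/

section Orbits

variable {n : ℕ}

/-- The two curves have compact images, and `P` is Lipschitz on their union; this reduces uniqueness
to the Lipschitz case. -/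
theorem IsSolutionOn.eqOn_Icc {P : Space n → Space n} (hP : LocallyLipschitz P)
    {γ₁ γ₂ : ℝ → Space n} {a b t₀ : ℝ} (h₁ : IsSolutionOn P γ₁ (Icc a b))
    (h₂ : IsSolutionOn P γ₂ (Icc a b)) (ht₀ : t₀ = a ∨ t₀ = b) (heq : γ₁ t₀ = γ₂ t₀) :
    EqOn γ₁ γ₂ (Icc a b) := by
  have hc₁ : ContinuousOn γ₁ (Icc a b) := fun t ht => (h₁ t ht).continuousWithinAt
  have hc₂ : ContinuousOn γ₂ (Icc a b) := fun t ht => (h₂ t ht).continuousWithinAt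
  obtain ⟨K, hK⟩ := LocallyLipschitzOn.exists_lipschitzOnWith_of_compact
    ((isCompact_Icc.image_of_continuousOn hc₁).union (isCompact_Icc.image_of_continuousOn hc₂))
    hP.locallyLipschitzOn
  rcases ht₀ with rfl | rfl
  · have hnhds : ∀ t ∈ Ico t₀ b, Icc t₀ b ∈ 𝓝[≥] t := fun t ht =>
      mem_of_superset (Icc_mem_nhdsGE ht.2) (Icc_subset_Icc_left ht.1)
    exact ODE_solution_unique_of_mem_Icc_right (v := fun _ => P) (fun _ _ => hK) hc₁
      (fun t ht => (h₁ t (Ico_subset_Icc_self ht)).mono_of_mem_nhdsWithin (hnhds t ht))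
      (fun t ht => Or.inl (mem_image_of_mem _ (Ico_subset_Icc_self ht))) hc₂
      (fun t ht => (h₂ t (Ico_subset_Icc_self ht)).mono_of_mem_nhdsWithin (hnhds t ht))
      (fun t ht => Or.inr (mem_image_of_mem _ (Ico_subset_Icc_self ht))) heq
  · have hnhds : ∀ t ∈ Ioc a t₀, Icc a t₀ ∈ 𝓝[≤] t := fun t ht =>
      mem_of_superset (Icc_mem_nhdsLE ht.1) (Icc_subset_Icc_right ht.2)
    exact ODE_solution_unique_of_mem_Icc_left (v := fun _ => P) (fun _ _ => hK) hc₁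
      (fun t ht => (h₁ t (Ioc_subset_Icc_self ht)).mono_of_mem_nhdsWithin (hnhds t ht))
      (fun t ht => Or.inl (mem_image_of_mem _ (Ioc_subset_Icc_self ht))) hc₂
      (fun t ht => (h₂ t (Ioc_subset_Icc_self ht)).mono_of_mem_nhdsWithin (hnhds t ht))
      (fun t ht => Or.inr (mem_image_of_mem _ (Ioc_subset_Icc_self ht))) heq

theorem IsSolutionOn.eqOn {P : Space n → Space n} (hP : LocallyLipschitz P)
    {γ₁ γ₂ : ℝ → Space n} {s : Set ℝ} (hs : s.OrdConnected) (h₁ : IsSolutionOn P γ₁ s)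
    (h₂ : IsSolutionOn P γ₂ s) {t₀ : ℝ} (ht₀ : t₀ ∈ s) (heq : γ₁ t₀ = γ₂ t₀) :
    EqOn γ₁ γ₂ s := by
  intro t ht
  rcases le_total t₀ t with h | h
  · have hsub := hs.out ht₀ ht
    exact IsSolutionOn.eqOn_Icc hP (IsIntegralCurveOn.mono h₁ hsub)
      (IsIntegralCurveOn.mono h₂ hsub) (Or.inl rfl) heq ⟨h, le_rfl⟩
  · have hsub := hs.out ht ht₀
    exact IsSolutionOn.eqOn_Icc hP (IsIntegralCurveOn.mono h₁ hsub)
      (IsIntegralCurveOn.mono h₂ hsub) (Or.inr rfl) heq ⟨le_rfl, h⟩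

variable {P : Space n → Space n} {β : ℝ → Space n}

theorem isSolutionOn_comp_add (hβ : ∀ t, HasDerivAt β (P (β t)) t) (c : ℝ) (s : Set ℝ) :
    IsSolutionOn P (fun t => β (t + c)) s := fun t _ =>
  ((hβ (t + c)).comp_add_const t c).hasDerivWithinAt

/-- By uniqueness a solution that meets the orbit is a time translate of `β`. -/
theorem isInvariantUnder_range (hP : LocallyLipschitz P) (hβ : ∀ t, HasDerivAt β (P (β t)) t) :
    IsInvariantUnder P (range β) := by
  rintro γ s hs hγ ⟨t₀, ht₀, τ, hτ⟩ t ht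
  have := IsSolutionOn.eqOn hP hs hγ (isSolutionOn_comp_add hβ (τ - t₀) s) ht₀ (by simp [hτ]) ht
  exact ⟨t + (τ - t₀), this.symm⟩

theorem contDiff_of_solution (hP : LocallyLipschitz P) (hβ : ∀ t, HasDerivAt β (P (β t)) t) :
    ContDiff ℝ 1 β := by
  have hd : deriv β = fun t => P (β t) := funext fun t => (hβ t).deriv
  have hc : Continuous β := continuous_iff_continuousAt.2 fun t => (hβ t).continuousAt
  exact contDiff_one_iff_deriv.2 ⟨fun t => (hβ t).differentiableAt, by
    rw [hd]; exact hP.continuous.comp hc⟩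

theorem injective_of_apply_ne_zero {L : Space 1 →L[ℝ] Space n} {v : Space 1} (hv : L v ≠ 0) :
    Function.Injective L := by
  have hv0 : v ≠ 0 := fun h => hv (by simp [h])
  refine (injective_iff_map_eq_zero L).2 fun w hw => ?_
  obtain ⟨c, rfl⟩ := exists_smul_eq_of_finrank_eq_one (K := ℝ) (by simp) hv0 w
  rw [map_smul, smul_eq_zero] at hw
  simp [hw.resolve_right hv]

theorem isImmersedSubmanifold_singleton (x : Space n) : IsImmersedSubmanifold 0 {x} := by
  refine ⟨Space 0, inferInstance, inferInstance, inferInstance, inferInstance, inferInstance,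
    inferInstance, fun _ => x, contMDiff_const, Function.injective_of_subsingleton _,
    fun y v w _ => ?_, range_const⟩
  exact Subsingleton.elim (α := Space 0) v w

theorem isImmersedSubmanifold_of_injective (hP : LocallyLipschitz P)
    (hβ : ∀ t, HasDerivAt β (P (β t)) t) (h0 : ∀ t, P (β t) ≠ 0) (hinj : Function.Injective β) :
    IsImmersedSubmanifold 1 (range β) := by
  have hcd : ContDiff ℝ 1 fun x : Space 1 => β (x 0) :=
    (contDiff_of_solution hP hβ).comp (by fun_prop)
  refine ⟨Space 1, inferInstance, inferInstance, inferInstance, inferInstance, inferInstance,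
    inferInstance, fun x => β (x 0), hcd.contMDiff, fun x y hxy => ?_, fun x => ?_, ?_⟩
  · ext i
    rw [Subsingleton.elim i 0]
    exact hinj hxy
  · rw [mfderiv_eq_fderiv]
    refine injective_of_apply_ne_zero (v := EuclideanSpace.single 0 1) ?_
    have h1 : HasFDerivAt (fun x : Space 1 => x 0) (EuclideanSpace.proj 0 : Space 1 →L[ℝ] ℝ) x :=
      (EuclideanSpace.proj 0 : Space 1 →L[ℝ] ℝ).hasFDerivAt
    have h2 := ((hβ (x 0)).hasFDerivAt.comp x h1).fderiv
    have h3 : fderiv ℝ (fun x : Space 1 => β (x 0)) x (EuclideanSpace.single 0 1) = P (β (x 0)) := by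
      simp only [Function.comp_def] at h2
      rw [h2]
      simp
    rw [h3]
    exact h0 _
  · refine Subset.antisymm (range_subset_iff.2 fun x => mem_range_self _)
      (range_subset_iff.2 fun t => ⟨EuclideanSpace.single 0 t, by simp⟩)

theorem isImmersedSubmanifold_of_periodic (hP : LocallyLipschitz P)
    (hβ : ∀ t, HasDerivAt β (P (β t)) t) (h0 : ∀ t, P (β t) ≠ 0) {T : ℝ} (hT : T ≠ 0)
    (hper : ∀ a b, β a = β b ↔ ∃ m : ℤ, a = b + m * T) :
    IsImmersedSubmanifold 1 (range β) := by
  -- The time `c * s` corresponds to the angle `s`. Periodicity makes the map on the circle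
  -- independent of the branch of the argument.
  set c : ℝ := T / (2 * Real.pi) with hc
  have hc0 : c ≠ 0 := div_ne_zero hT (by positivity)
  have hcT : c * (2 * Real.pi) = T := div_mul_cancel₀ _ (by positivity)
  set f : Circle → Space n := fun z => β (c * Complex.arg z) with hf
  have hfexp : ∀ s, f (Circle.exp s) = β (c * s) := by
    intro s
    obtain ⟨m, hm⟩ := Circle.exp_eq_exp.1 (Circle.exp_arg (Circle.exp s))
    refine (hper _ _).2 ⟨m, ?_⟩
    rw [hm, ← hcT]; ring
  have hg : ContDiff ℝ 1 fun s => β (c * s) := (contDiff_of_solution hP hβ).comp (by fun_prop)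
  have hsmooth : ContMDiff (𝓡 1) (𝓡 n) 1 f := by
    intro z
    obtain ⟨s, rfl⟩ := Circle.exp_surjective z
    -- Rotating the base point to 1 moves it away from the branch cut of `arg`.
    have hloc : f = fun w : Circle => β (c * (s + Complex.arg ((w : ℂ) * (Circle.exp (-s) : Circle)))) := by
      funext w
      rw [← hfexp, Circle.exp_add, ← Circle.coe_mul, Circle.exp_arg, mul_comm w, ← mul_assoc,
        ← Circle.exp_add]
      simp
    rw [hloc]
    have h1 : ContMDiffAt (𝓡 1) 𝓘(ℝ, ℂ) 1
        (fun w : Circle => ((w : ℂ))) (Circle.exp s) :=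
      haveI : Fact (Module.finrank ℝ ℂ = 1 + 1) := ⟨Complex.finrank_real_complex⟩
      contMDiff_coe_sphere.contMDiffAt
    have h2 : ContDiffAt ℝ 1
        (fun w : ℂ => β (c * (s + Complex.arg (w * (Circle.exp (-s) : Circle)))))
        (Circle.exp s : ℂ) := by
      have h3 : ContDiffAt ℝ 1 Complex.arg ((Circle.exp s : ℂ) * (Circle.exp (-s) : Circle)) := by
        have h4 : (Circle.exp s : ℂ) * (Circle.exp (-s) : Circle) = 1 := by
          rw [← Circle.coe_mul, ← Circle.exp_add]; simp
        rw [h4]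
        have h5 : ContDiffAt ℝ 1 Complex.log 1 :=
          (Complex.contDiffAt_log (by simp)).restrict_scalars ℝ
        have h6 : Complex.arg = fun w => Complex.imCLM (Complex.log w) := by
          funext w; simp [Complex.log_im]
        rw [h6]
        exact Complex.imCLM.contDiff.contDiffAt.comp _ h5
      have h7 : ContDiffAt ℝ 1 (fun w : ℂ => Complex.arg (w * (Circle.exp (-s) : Circle)))
          (Circle.exp s : ℂ) := 
        ContDiffAt.comp (f := fun w : ℂ => w * (Circle.exp (-s) : Circle)) _ h3 (by fun_prop)
      exact (contDiff_of_solution hP hβ).contDiffAt.comp _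
        (contDiffAt_const.mul (contDiffAt_const.add h7))
    exact h2.contMDiffAt.comp _ h1
  refine ⟨Circle, inferInstance, inferInstance, IsManifold.of_le (n := ω) le_top, inferInstance,
    inferInstance, inferInstance, f, hsmooth, fun z w hzw => ?_, fun z => ?_, ?_⟩
  · obtain ⟨s, rfl⟩ := Circle.exp_surjective z
    obtain ⟨s', rfl⟩ := Circle.exp_surjective w
    rw [hfexp, hfexp, hper] at hzw
    obtain ⟨m, hm⟩ := hzw
    refine Circle.exp_eq_exp.2 ⟨m, mul_left_cancel₀ hc0 ?_⟩
    rw [hm, ← hcT]; ring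
  · obtain ⟨s, rfl⟩ := Circle.exp_surjective z
    have h1 : MDifferentiableAt (𝓡 1) (𝓡 n) f (Circle.exp s) :=
      (hsmooth _).mdifferentiableAt one_ne_zero
    have h2 : MDifferentiableAt 𝓘(ℝ, ℝ) (𝓡 1) Circle.exp s :=
      (contMDiff_circleExp (m := 1) s).mdifferentiableAt one_ne_zero
    -- By the chain rule with the exponential, the derivative of `f` takes some tangent vector to c
    -- P ≠ 0; in dimension one this is injectivity.
    have h3 := mfderiv_comp s h1 h2
    have h4 : f ∘ Circle.exp = fun s => β (c * s) := funext hfexp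
    have h5 : HasDerivAt (fun s => β (c * s)) (c • P (β (c * s))) s := by
      simpa [Function.comp_def] using (hβ (c * s)).scomp s ((hasDerivAt_id s).const_mul c)
    rw [h4, mfderiv_eq_fderiv] at h3
    have h6 : fderiv ℝ (fun s => β (c * s)) s 1 = c • P (β (c * s)) := by
      simpa using h5.deriv
    rw [h3] at h6
    refine injective_of_apply_ne_zero (v := mfderiv 𝓘(ℝ, ℝ) (𝓡 1) Circle.exp s (1 : ℝ)) ?_
    refine ne_of_eq_of_ne h6 (smul_ne_zero hc0 (h0 _))
  · refine Subset.antisymm (range_subset_iff.2 fun x => mem_range_self _)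
      (range_subset_iff.2 fun t => ⟨Circle.exp (t / c), ?_⟩)
    rw [hfexp, mul_div_cancel₀ _ hc0]

/-- A complete orbit is an invariant submanifold: an equilibrium, a closed orbit, or an injectively
immersed line. -/
theorem isInvariantSubmanifold_range (hP : LocallyLipschitz P)
    (hβ : ∀ t, HasDerivAt β (P (β t)) t) : IsInvariantSubmanifold P (range β) := by
  refine ⟨?_, isInvariantUnder_range hP hβ⟩
  by_cases h0 : ∀ t, P (β t) ≠ 0
  swap
  · push Not at h0
    obtain ⟨t, ht⟩ := h0
    have hconst : IsSolutionOn P (fun _ => β t) univ := fun s _ => by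
      change HasDerivWithinAt _ (P (β t)) _ _
      rw [ht]; exact hasDerivWithinAt_const _ _ _
    have h1 := IsSolutionOn.eqOn hP ordConnected_univ
      (fun s _ => (hβ s).hasDerivWithinAt) hconst (mem_univ t) rfl
    have h2 : range β = {β t} :=
      Subset.antisymm (range_subset_iff.2 fun s => h1 (mem_univ s))
        (singleton_subset_iff.2 (mem_range_self t))
    exact ⟨0, h2 ▸ isImmersedSubmanifold_singleton _⟩
  refine ⟨1, ?_⟩
  have hcont : Continuous β := continuous_iff_continuousAt.2 fun t => (hβ t).continuousAt
  have hshift : ∀ a b, β a = β b → ∀ t, β (t + (b - a)) = β t := fun a b hab t => by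
    refine IsSolutionOn.eqOn hP ordConnected_univ (isSolutionOn_comp_add hβ (b - a) univ)
      (isSolutionOn_comp_add hβ 0 univ) (mem_univ a) ?_ (mem_univ t) |>.trans (by simp)
    simp [hab]
  -- The periods form a closed subgroup of ℝ. If dense, it is everything and `β` is constant,
  -- against P ≠ 0; otherwise it is cyclic, and a zero generator means that `β` is injective.
  let S : AddSubgroup ℝ :=
    { carrier := {p | ∀ t, β (t + p) = β t}
      zero_mem' := fun t => by simp
      add_mem' := fun {p q} hp hq t => by rw [← add_assoc, hq, hp]
      neg_mem' := fun {p} hp t => by rw [← hp (t + -p)]; simp }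
  have hS : ∀ a b, β a = β b ↔ a - b ∈ S := fun a b =>
    ⟨fun h => hshift b a h.symm, fun h => by simpa using h b⟩
  have hSclosed : IsClosed (S : Set ℝ) := by
    have : (S : Set ℝ) = ⋂ t, {p | β (t + p) = β t} := by
      ext p; simp [S]
    rw [this]
    exact isClosed_iInter fun t => isClosed_eq (by fun_prop) continuous_const
  rcases S.dense_or_cyclic with hd | ⟨T, hT⟩
  · have huniv : (S : Set ℝ) = univ := by rw [← hSclosed.closure_eq]; exact hd.closure_eq
    have hconst : β = fun _ => β 0 := funext fun t => (hS t 0).2 (by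
      rw [← SetLike.mem_coe, huniv]; trivial)
    exfalso
    refine h0 0 ((hβ 0).unique ?_)
    rw [hconst]
    exact hasDerivAt_const _ _
  · have hper : ∀ a b, β a = β b ↔ ∃ m : ℤ, a = b + m * T := fun a b => by
      rw [hS, hT, AddSubgroup.mem_closure_singleton]
      refine exists_congr fun m => ?_
      rw [zsmul_eq_mul]
      constructor <;> intro h <;> linarith
    by_cases hT0 : T = 0
    · refine isImmersedSubmanifold_of_injective hP hβ h0 fun a b hab => ?_
      obtain ⟨m, hm⟩ := (hper a b).1 hab
      simpa [hT0] using hm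
    · exact isImmersedSubmanifold_of_periodic hP hβ h0 hT0 hper

end Orbits

/-! ### Ambient isotopies and linear shears -/

section Isotopy

variable {n : ℕ}

theorem isHomeomorph_of_inverse {X : Type*} [TopologicalSpace X] {f g : X → X}
    (hf : Continuous f) (hg : Continuous g) (hl : ∀ x, g (f x) = x) (hr : ∀ x, f (g x) = x) :
    IsHomeomorph f :=
  isHomeomorph_iff_exists_inverse.2 ⟨hf, g, hl, hr, hg⟩

namespace IsFinalMapOfIsotopy

theorem isHomeomorph {φ : Space n → Space n} (h : IsFinalMapOfIsotopy φ) : IsHomeomorph φ := by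
  obtain ⟨H, -, hH, -, h1⟩ := h
  simpa [h1] using hH 1

protected theorem id : IsFinalMapOfIsotopy (id : Space n → Space n) :=
  ⟨Prod.fst, continuous_fst, fun _ => IsHomeomorph.id, fun _ => rfl, fun _ => rfl⟩

theorem comp {φ ψ : Space n → Space n} (hφ : IsFinalMapOfIsotopy φ)
    (hψ : IsFinalMapOfIsotopy ψ) : IsFinalMapOfIsotopy (φ ∘ ψ) := by
  obtain ⟨H, hc, hH, h0, h1⟩ := hφ
  obtain ⟨H', hc', hH', h0', h1'⟩ := hψ
  exact ⟨fun p => H (H' p, p.2), by fun_prop, fun t => (hH t).comp (hH' t),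
    fun x => by simp [h0, h0'], fun x => by simp [h1, h1']⟩

theorem iterate {φ : Space n → Space n} (hφ : IsFinalMapOfIsotopy φ) (m : ℕ) :
    IsFinalMapOfIsotopy φ^[m] := by
  induction m with
  | zero => exact .id
  | succ m ih => exact ih.comp hφ

/-- The path φ⁻¹ ∘ H_{1-t} runs from the identity to φ⁻¹; joint continuity of the inverses H_t⁻¹ is
not needed. -/
theorem exists_inverse {φ : Space n → Space n} (hφ : IsFinalMapOfIsotopy φ) :
    ∃ ψ, IsFinalMapOfIsotopy ψ ∧ (∀ x, ψ (φ x) = x) ∧ ∀ x, φ (ψ x) = x := by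
  obtain ⟨ψ, hl, hr, hψ⟩ := (isHomeomorph_iff_exists_inverse.1 hφ.isHomeomorph).2
  obtain ⟨H, hc, hH, h0, h1⟩ := hφ
  refine ⟨ψ, ⟨fun p => ψ (H (p.1, unitInterval.symm p.2)), by fun_prop, fun t => ?_,
    fun x => ?_, fun x => ?_⟩, hl, hr⟩
  · have : IsHomeomorph ψ := isHomeomorph_iff_exists_inverse.2
      ⟨hψ, φ, hr, hl, by simpa [h1] using (hH 1).continuous⟩
    exact this.comp (hH (unitInterval.symm t))
  · simp [h1, hl x]
  · simp [h0]

/-- Each id + t q is a perturbation of the identity with Lipschitz constant below 1, hence a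
homeomorphism. -/
theorem add_of_lipschitz {q : Space n → Space n} {c : ℝ≥0} (hq : LipschitzWith c q) (hc : c < 1) :
    IsFinalMapOfIsotopy fun x => x + q x := by
  have hqc := hq.continuous
  refine ⟨fun p => p.1 + (p.2 : ℝ) • q p.1, by fun_prop, fun t => ?_, by simp, by simp⟩
  have hA : ApproximatesLinearOn (fun x => x + (t : ℝ) • q x)
      ((ContinuousLinearEquiv.refl ℝ (Space n) : Space n ≃L[ℝ] Space n) : Space n →L[ℝ] Space n)
      univ c := by
    intro x _ y _
    have h1 : x + (t : ℝ) • q x - (y + (t : ℝ) • q y) - (x - y) = (t : ℝ) • (q x - q y) := by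
      rw [smul_sub]; abel
    simp only [ContinuousLinearEquiv.coe_refl, ContinuousLinearMap.coe_id', id_eq]
    rw [h1, norm_smul, Real.norm_of_nonneg t.2.1, ← dist_eq_norm, ← dist_eq_norm]
    calc (t : ℝ) * dist (q x) (q y) ≤ 1 * dist (q x) (q y) := by gcongr; exact t.2.2
      _ ≤ c * dist x y := by rw [one_mul]; exact hq.dist_le_mul x y
  rcases subsingleton_or_nontrivial (Space n) with hs | hs
  · exact (hA.toHomeomorph _ (Or.inl hs)).isHomeomorph
  · refine (hA.toHomeomorph _ (Or.inr ?_)).isHomeomorph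
    have h2 : ‖((ContinuousLinearEquiv.refl ℝ (Space n)).symm : Space n →L[ℝ] Space n)‖₊ = 1 := by
      rw [ContinuousLinearEquiv.refl_symm, ContinuousLinearEquiv.coe_refl]
      exact ContinuousLinearMap.nnnorm_id
    rw [h2, inv_one]
    exact hc

theorem flow {V : Space n → Space n} {Φ : ℝ → Space n → Space n} {K : ℝ≥0} (hΦ : IsFlow V Φ)
    (hV : LipschitzWith K V) (T : ℝ) : IsFinalMapOfIsotopy (Φ T) := by
  have hc := hΦ.continuous_uncurry hV
  refine ⟨fun p => Φ (p.2 * T) p.1, hc.comp (by fun_prop :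
    Continuous fun p : Space n × unitInterval => ((p.2 : ℝ) * T, p.1)),
    fun t => hΦ.isHomeomorph hV (t * T), fun x => by simp [hΦ.zero], fun x => by simp⟩

/-- The rank-one perturbation id + s a(·)p has determinant 1 + s a(p) ≥ 1 throughout the isotopy;
its inverse is given by the Sherman–Morrison formula. -/
theorem add_smul_of_nonneg {a : Space n →L[ℝ] ℝ} {p : Space n} (hap : 0 ≤ a p) {C : ℝ}
    (hC : 0 ≤ C) : IsFinalMapOfIsotopy fun x => x + (C * a x) • p := by
  refine ⟨fun q => q.1 + ((q.2 : ℝ) * C * a q.1) • p, by fun_prop, fun t => ?_, by simp, by simp⟩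
  set s : ℝ := t * C
  have hs : 0 ≤ s := mul_nonneg t.2.1 hC
  have h1 : 1 + s * a p ≠ 0 := by positivity
  refine isHomeomorph_of_inverse (g := fun x => x - (s / (1 + s * a p) * a x) • p)
    (by fun_prop) (by fun_prop) (fun x => ?_) fun x => ?_
  · simp only [map_add, map_smul, smul_eq_mul]
    rw [add_sub_assoc, ← sub_smul]
    have : s * a x - s / (1 + s * a p) * (a x + s * a x * a p) = 0 := by field_simp; ring
    rw [this, zero_smul, add_zero]
  · simp only [map_sub, map_smul, smul_eq_mul]
    rw [sub_add, ← sub_smul]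
    have : s / (1 + s * a p) * a x - s * (a x - s / (1 + s * a p) * a x * a p) = 0 := by
      field_simp; ring
    rw [this, zero_smul, sub_zero]

end IsFinalMapOfIsotopy

/-- Rotation by the angle `θ` in the plane of the coordinates `i` and `j`. -/
noncomputable def planeRotation (i j : Fin n) (θ : ℝ) (x : Space n) : Space n :=
  x + ((Real.cos θ - 1) * x i - Real.sin θ * x j) • EuclideanSpace.single i (1 : ℝ) +
    ((Real.cos θ - 1) * x j + Real.sin θ * x i) • EuclideanSpace.single j (1 : ℝ)

theorem planeRotation_neg {i j : Fin n} (hij : i ≠ j) (θ : ℝ) (x : Space n) :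
    planeRotation i j (-θ) (planeRotation i j θ x) = x := by
  have h1 := Real.sin_sq_add_cos_sq θ
  ext l
  by_cases hi : l = i
  · subst hi
    simp [planeRotation, hij, hij.symm]
    linear_combination x l * h1
  by_cases hj : l = j
  · subst hj
    simp [planeRotation, hij, hij.symm]
    linear_combination x l * h1
  simp [planeRotation, hi, hj]

theorem isFinalMapOfIsotopy_planeRotation {i j : Fin n} (hij : i ≠ j) (θ : ℝ) :
    IsFinalMapOfIsotopy (planeRotation i j θ) := by
  refine ⟨fun p => planeRotation i j (p.2 * θ) p.1, ?_, fun t => ?_, fun x => ?_, fun x => ?_⟩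
  · unfold planeRotation; fun_prop
  · refine isHomeomorph_of_inverse (g := planeRotation i j (-(t * θ))) ?_ ?_
      (planeRotation_neg hij _) fun x => ?_
    · unfold planeRotation; fun_prop
    · unfold planeRotation; fun_prop
    · simpa using planeRotation_neg hij (-(t * θ)) x
  · simp [planeRotation]
  · simp

/-- The rotation by a half turn in the plane of the coordinates `i` and `j`. -/
noncomputable def halfTurn (i j : Fin n) : Space n →L[ℝ] Space n :=
  ContinuousLinearMap.id ℝ (Space n)
    - (2 : ℝ) • (EuclideanSpace.proj i : Space n →L[ℝ] ℝ).smulRight (EuclideanSpace.single i (1 : ℝ))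
    - (2 : ℝ) • (EuclideanSpace.proj j : Space n →L[ℝ] ℝ).smulRight (EuclideanSpace.single j (1 : ℝ))

theorem halfTurn_eq (i j : Fin n) (x : Space n) : halfTurn i j x = planeRotation i j Real.pi x := by
  simp only [halfTurn, planeRotation, Real.cos_pi, Real.sin_pi]
  ext l
  simp
  split_ifs <;> ring

theorem halfTurn_halfTurn {i j : Fin n} (hij : i ≠ j) (x : Space n) :
    halfTurn i j (halfTurn i j x) = x := by
  ext l
  by_cases hi : l = i
  · subst hi
    simp [halfTurn, hij, hij.symm]; ring
  by_cases hj : l = j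
  · subst hj
    simp [halfTurn, hij, hij.symm]; ring
  simp [halfTurn, hi, hj]

/-- To the all-ones vector v one adds enough of the i-th basis vector to outweigh a(v). -/
theorem exists_pos_of_apply_single_pos {a : Space n →L[ℝ] ℝ} {i : Fin n}
    (hi : 0 < a (EuclideanSpace.single i 1)) : ∃ p : Space n, (∀ l, 0 < p l) ∧ 0 ≤ a p := by
  set v : Space n := WithLp.toLp 2 fun _ => (1 : ℝ)
  set w : Space n := EuclideanSpace.single i 1
  refine ⟨v + (|a v| / a w) • w, fun l => ?_, ?_⟩
  · have h1 : 0 ≤ |a v| / a w := by positivity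
    by_cases hl : l = i
    · subst hl
      simp [v, w]; positivity
    · simp [v, w, hl]
  · simp only [map_add, map_smul, smul_eq_mul]
    rw [div_mul_cancel₀ _ hi.ne']
    linarith [neg_abs_le (a v)]

/-- In dimension at least two, arbitrarily large positive multiples of one linear coordinate can be
added, after a rotation, to all coordinates by maps that are isotopic to the identity. -/
theorem exists_isotopy_shear (hn : 2 ≤ n) (A : Space n ≃L[ℝ] Space n) (k : Fin n) :
    ∃ (B : Space n →L[ℝ] Space n) (p : Space n), (∀ i, 0 < p i) ∧ ∀ C : ℝ, 0 ≤ C →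
      ∃ g, IsFinalMapOfIsotopy g ∧ ∀ u, g (A u) = B u + (C * u k) • p := by
  -- This is the tube coordinate u_k expressed through x = A u.
  set a : Space n →L[ℝ] ℝ := (EuclideanSpace.proj k : Space n →L[ℝ] ℝ) ∘L
    (A.symm : Space n →L[ℝ] Space n) with ha
  have haA : ∀ u, a (A u) = u k := fun u => by simp [ha]
  have hex : ∃ i, a (EuclideanSpace.single i 1) ≠ 0 := by
    by_contra! h
    have h0 : a = 0 := by
      ext x
      have hx : x = ∑ i, x i • EuclideanSpace.single i (1 : ℝ) := by
        ext l; simp [Finset.sum_apply, Pi.single_apply]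
      rw [hx]; simp [h]
    have := haA (EuclideanSpace.single k 1)
    simp [h0] at this
  by_cases hpos : ∃ i, 0 < a (EuclideanSpace.single i 1)
  · obtain ⟨i, hi⟩ := hpos
    obtain ⟨p, hp, hap⟩ := exists_pos_of_apply_single_pos hi
    exact ⟨A, p, hp, fun C hC => ⟨_, .add_smul_of_nonneg hap hC, fun u => by simp [haA]⟩⟩
  · push Not at hpos
    obtain ⟨i, hi⟩ := hex
    have : Nontrivial (Fin n) := Fin.nontrivial_iff_two_le.2 hn
    -- Now `a` is negative on the i-th basis vector. A half turn in the (i, j)-plane reverses this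
    -- vector and, unlike a reflection, is isotopic to the identity.
    obtain ⟨j, hj⟩ := exists_ne i
    have hQ : IsFinalMapOfIsotopy (halfTurn i j) := by
      have : (halfTurn i j : Space n → Space n) = planeRotation i j Real.pi :=
        funext (halfTurn_eq i j)
      rw [this]
      exact isFinalMapOfIsotopy_planeRotation hj.symm _
    have hi' : 0 < (a ∘L halfTurn i j) (EuclideanSpace.single i 1) := by
      have : halfTurn i j (EuclideanSpace.single i 1) = -EuclideanSpace.single i (1 : ℝ) := by
        ext l
        by_cases hl : l = i
        · subst hl; simp [halfTurn, hj.symm]; norm_num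
        · simp [halfTurn, hl, hj]
      simp only [ContinuousLinearMap.comp_apply, this, map_neg]
      linarith [lt_of_le_of_ne (hpos i) hi]
    obtain ⟨p, hp, hap⟩ := exists_pos_of_apply_single_pos hi'
    refine ⟨halfTurn i j ∘L (A : Space n →L[ℝ] Space n), p, hp, fun C hC =>
      ⟨_, (IsFinalMapOfIsotopy.add_smul_of_nonneg hap hC).comp hQ, fun u => ?_⟩⟩
    simp [halfTurn_halfTurn hj.symm, haA]

end Isotopy

/-! ### Straightening the chart on the cube by an ambient isotopy -/

section Chart

variable {n : ℕ}

/-- Cutting off makes a locally Lipschitz field globally Lipschitz and bounded. For x in `S` and y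
outside, |χ x| ≤ c d(x, y), so only the bound of `P` on `S` enters. -/
theorem exists_lipschitzWith_smul {E F : Type*} [PseudoMetricSpace E] [NormedAddCommGroup F]
    [NormedSpace ℝ F] {P : E → F} (hP : LocallyLipschitz P) {χ : E → ℝ} {c : ℝ≥0}
    (hχ : LipschitzWith c χ) {S : Set E} (hS : IsCompact S) (h0 : ∀ x ∉ S, χ x = 0) :
    ∃ K M : ℝ≥0, LipschitzWith K (fun x => χ x • P x) ∧ ∀ x, ‖χ x • P x‖ ≤ M := by
  obtain ⟨K, hK⟩ := LocallyLipschitzOn.exists_lipschitzOnWith_of_compact hS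
    (hP.locallyLipschitzOn)
  obtain ⟨M, hM⟩ := hS.exists_bound_of_continuousOn hP.continuous.continuousOn
  obtain ⟨D, hD⟩ := hS.exists_bound_of_continuousOn hχ.continuous.continuousOn
  have hM' : ∀ x ∈ S, ‖P x‖ ≤ M.toNNReal := fun x hx => (hM x hx).trans (Real.le_coe_toNNReal M)
  have hD' : ∀ x ∈ S, ‖χ x‖ ≤ D.toNNReal := fun x hx => (hD x hx).trans (Real.le_coe_toNNReal D)
  have hout : ∀ x y, y ∉ S → dist (χ x • P x) (χ y • P y) ≤ c * M.toNNReal * dist x y := by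
    intro x y hy
    by_cases hx : x ∈ S
    · rw [h0 y hy, zero_smul, dist_zero_right, norm_smul]
      have h1 : ‖χ x‖ ≤ c * dist x y := by
        have := hχ.dist_le_mul x y
        rwa [h0 y hy, dist_zero_right] at this
      calc ‖χ x‖ * ‖P x‖ ≤ (c * dist x y) * M.toNNReal := by gcongr; exact hM' x hx
        _ = _ := by ring
    · simp only [h0 y hy, h0 x hx, zero_smul, dist_self]
      positivity
  refine ⟨D.toNNReal * K + c * M.toNNReal, D.toNNReal * M.toNNReal,
    LipschitzWith.of_dist_le_mul fun x y => ?_, fun x => ?_⟩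
  · have hpos : 0 ≤ (D.toNNReal : ℝ) * K * dist x y := by positivity
    push_cast
    rw [add_mul]
    by_cases hy : y ∈ S
    · by_cases hx : x ∈ S
      · calc dist (χ x • P x) (χ y • P y)
            ≤ dist (χ x • P x) (χ x • P y) + dist (χ x • P y) (χ y • P y) := dist_triangle _ _ _
          _ = ‖χ x‖ * dist (P x) (P y) + dist (χ x) (χ y) * ‖P y‖ := by
            rw [dist_smul₀, dist_eq_norm (χ x • P y), ← sub_smul, norm_smul, Real.dist_eq,
              Real.norm_eq_abs (χ x - χ y)]
          _ ≤ D.toNNReal * (K * dist x y) + (c * dist x y) * M.toNNReal := by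
            gcongr
            · exact hD' x hx
            · exact hK.dist_le_mul x hx y hy
            · exact hχ.dist_le_mul x y
            · exact hM' y hy
          _ = _ := by ring
      · have := hout y x hx
        rw [dist_comm, dist_comm y x] at this
        linarith
    · linarith [hout x y hy]
  · by_cases hx : x ∈ S
    · rw [norm_smul, NNReal.coe_mul]
      gcongr
      · exact hD' x hx
      · exact hM' x hx
    · simp only [h0 x hx, zero_smul, norm_zero]
      positivity

open Classical in
/-- The map `r`, transported by the chart `e` and extended by the identity. -/
noncomputable def chartConj {X : Type*} [TopologicalSpace X] (e : OpenPartialHomeomorph X X)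
    (r : X → X) (x : X) : X :=
  if x ∈ e.source then e.symm (r (e x)) else x

section ChartConj

variable {X : Type*} [TopologicalSpace X] {e : OpenPartialHomeomorph X X} {K : Set X}

theorem chartConj_symm_apply (r : X → X) {u : X} (hu : u ∈ e.target) :
    chartConj e r (e.symm u) = e.symm (r u) := by
  rw [chartConj, if_pos (e.map_target hu), e.right_inv hu]

/-- If r u lies outside `K`, then r fixes it, and injectivity gives r u = u. -/
theorem mem_target_of_injective (hK : K ⊆ e.target) {r : X → X} (hr : Function.Injective r)
    (hid : ∀ u ∉ K, r u = u) {u : X} (hu : u ∈ e.target) : r u ∈ e.target := by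
  by_cases h : r u ∈ K
  · exact hK h
  · rwa [hr (hid _ h)]

theorem chartConj_chartConj (hK : K ⊆ e.target) {r r' : X → X} (hr : Function.Injective r)
    (hid : ∀ u ∉ K, r u = u) (hl : ∀ u, r' (r u) = u) (x : X) :
    chartConj e r' (chartConj e r x) = x := by
  by_cases hx : x ∈ e.source
  · have h1 := mem_target_of_injective hK hr hid (e.map_source hx)
    rw [chartConj.eq_1 e r, if_pos hx, chartConj_symm_apply _ h1, hl, e.left_inv hx]
  · rw [chartConj.eq_1 e r, if_neg hx, chartConj, if_neg hx]

/-- Two open sets cover the space: the chart domain, and the complement of the compact image of `K`,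
on which the map is the identity. The parameter `y` serves as isotopy time. -/
theorem continuous_chartConj [T2Space X] (hKc : IsCompact K) (hK : K ⊆ e.target) {Y : Type*}
    [TopologicalSpace Y] {R : X × Y → X} (hR : Continuous R)
    (hinj : ∀ y, Function.Injective fun u => R (u, y)) (hid : ∀ u ∉ K, ∀ y, R (u, y) = u) :
    Continuous fun p : X × Y => chartConj e (fun u => R (u, p.2)) p.1 := by
  refine continuous_iff_continuousAt.2 fun ⟨x, y⟩ => ?_
  by_cases hx : x ∈ e.source
  · have h1 : ContinuousAt (fun p : X × Y => e.symm (R (e p.1, p.2))) (x, y) := by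
      have h2 : ContinuousAt (fun p : X × Y => (e p.1, p.2)) (x, y) :=
        ((e.continuousAt hx).comp continuousAt_fst).prodMk continuousAt_snd
      have h3 : ContinuousAt (fun p : X × Y => R (e p.1, p.2)) (x, y) :=
        hR.continuousAt.comp h2
      exact ContinuousAt.comp (g := e.symm) (e.symm.continuousAt
        (mem_target_of_injective hK (hinj y) (fun u hu => hid u hu y) (e.map_source hx))) h3
    refine h1.congr ?_
    filter_upwards [(e.open_source.preimage continuous_fst).mem_nhds (show (x, y).1 ∈ _ from hx)]
      with p hp
    exact (if_pos hp).symm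
  · have hclosed : IsClosed (e.symm '' K) :=
      (hKc.image_of_continuousOn (e.symm.continuousOn.mono hK)).isClosed
    have hx' : x ∉ e.symm '' K := by
      rintro ⟨u, hu, rfl⟩
      exact hx (e.map_target (hK hu))
    refine (continuousAt_fst (X := X) (Y := Y)).congr ?_
    filter_upwards [(hclosed.isOpen_compl.preimage continuous_fst).mem_nhds
      (mem_preimage.2 (mem_compl hx') : (x, y) ∈ Prod.fst ⁻¹' _)] with p hp
    by_cases h : p.1 ∈ e.source
    · have h4 : e p.1 ∉ K := fun h5 => hp ⟨e p.1, h5, e.left_inv h⟩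
      rw [chartConj, if_pos h, hid _ h4, e.left_inv h]
    · rw [chartConj, if_neg h]

end ChartConj

theorem isFinalMapOfIsotopy_chartConj {e : OpenPartialHomeomorph (Space n) (Space n)}
    {K : Set (Space n)} (hKc : IsCompact K) (hK : K ⊆ e.target)
    {R : Space n × unitInterval → Space n} (hR : Continuous R)
    (hh : ∀ t, IsHomeomorph fun u => R (u, t)) (hid : ∀ u ∉ K, ∀ t, R (u, t) = u)
    (h0 : ∀ u, R (u, 0) = u) : IsFinalMapOfIsotopy (chartConj e fun u => R (u, 1)) := by
  have hc := continuous_chartConj (e := e) hKc hK hR (fun t => (hh t).injective) hid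
  refine ⟨_, hc, fun t => ?_, fun x => ?_, fun x => rfl⟩
  · obtain ⟨r, hl, hr, hrc⟩ := (isHomeomorph_iff_exists_inverse.1 (hh t)).2
    have hrinj : Function.Injective r := hr.injective
    have hrid : ∀ u ∉ K, r u = u := fun u hu => by
      have := hl u
      simpa [hid u hu t] using this
    have hc' := continuous_chartConj (e := e) hKc hK (Y := Unit) (R := fun p => r p.1)
      (hrc.comp continuous_fst) (fun _ => hrinj) (fun u hu _ => hrid u hu)
    refine isHomeomorph_of_inverse (g := chartConj e r) (hc.comp (by fun_prop :
      Continuous fun x : Space n => (x, t))) (hc'.comp (by fun_prop :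
      Continuous fun x : Space n => (x, ()))) (fun x => ?_) fun x => ?_
    · exact chartConj_chartConj hK (hh t).injective (fun u hu => hid u hu t) hl x
    · exact chartConj_chartConj (r' := fun u => R (u, t)) hK hrinj hrid hr x
  · simp only [chartConj, h0]
    split_ifs with h
    · exact e.left_inv h
    · rfl

theorem isCompact_cube (n : ℕ) : IsCompact (cube n) := by
  refine isCompact_of_isClosed_isBounded ?_ ?_
  · have : cube n = ⋂ i, {u : Space n | |u i| ≤ 1} := by ext; simp [cube]
    rw [this]
    exact isClosed_iInter fun i => isClosed_le (by fun_prop) continuous_const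
  · refine (isBounded_iff_forall_norm_le).2 ⟨√n, fun u hu => ?_⟩
    rw [EuclideanSpace.norm_eq]
    refine Real.sqrt_le_sqrt ?_
    calc ∑ i, ‖u i‖ ^ 2 ≤ ∑ _i : Fin n, (1 : ℝ) := by
          gcongr with i
          exact pow_le_one₀ (norm_nonneg _) (hu i)
      _ = n := by simp

theorem zero_mem_cube : (0 : Space n) ∈ cube n := fun i => by simp

theorem smul_mem_cube {u : Space n} (hu : u ∈ cube n) {s : ℝ} (hs : 0 ≤ s) (hs1 : s ≤ 1) :
    s • u ∈ cube n := fun i => by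
  rw [PiLp.smul_apply, smul_eq_mul, abs_mul, abs_of_nonneg hs]
  exact mul_le_one₀ hs1 (abs_nonneg _) (hu i)

/-- The image of the cube can be shrunk radially in the chart by an ambient isotopy. -/
theorem exists_isotopy_shrink {e : OpenPartialHomeomorph (Space n) (Space n)}
    (hcube : cube n ⊆ e.target) : ∃ s : ℝ, 0 < s ∧ s < 1 ∧ ∃ h, IsFinalMapOfIsotopy h ∧
      ∀ u ∈ cube n, h (e.symm u) = e.symm (s • u) := by
  obtain ⟨K, hKc, hK1, hK2⟩ := exists_compact_between (isCompact_cube n) e.open_target hcube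
  obtain ⟨χ, c, hχ, hχ0, hχ1⟩ : ∃ (χ : Space n → ℝ) (c : ℝ≥0), LipschitzWith c χ ∧
      (∀ u ∉ K, χ u = 0) ∧ ∀ u ∈ cube n, χ u = 1 := by
    rcases (Kᶜ).eq_empty_or_nonempty with he | hne
    · exact ⟨fun _ => 1, 0, LipschitzWith.const 1, fun u hu => absurd (he ▸ hu : u ∈ (∅ : Set _))
        (notMem_empty u), fun _ _ => rfl⟩
    obtain ⟨u₀, hu₀, hmin⟩ := (isCompact_cube n).exists_isMinOn ⟨0, zero_mem_cube⟩
      (continuous_infDist_pt Kᶜ).continuousOn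
    have hd : 0 < infDist u₀ Kᶜ := by
      rw [← infDist_closure]
      refine (isClosed_closure.notMem_iff_infDist_pos hne.closure).1 ?_
      rw [closure_compl, mem_compl_iff, not_not]
      exact hK1 hu₀
    set d := infDist u₀ Kᶜ
    refine ⟨fun u => min 1 (d⁻¹ * infDist u Kᶜ), _,
      ((lipschitzWith_smul d⁻¹).comp (lipschitz_infDist_pt Kᶜ)).const_min 1, fun u hu => ?_,
      fun u hu => ?_⟩
    · have : infDist u Kᶜ = 0 := infDist_zero_of_mem hu
      simp [this]
    · refine min_eq_left ?_
      have := hmin hu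
      rw [inv_mul_eq_div, one_le_div hd]
      exact this
  obtain ⟨L, -, hL, -⟩ := exists_lipschitzWith_smul (P := fun u : Space n => u)
    (LipschitzWith.id.locallyLipschitz) hχ hKc hχ0
  -- Since s L < 1, the maps u - t s χ(u) u are homeomorphisms for t in [0, 1]. On the cube the last
  -- one is multiplication by 1 - s.
  set s : ℝ := 1 / (2 * (L + 1)) with hs
  have hs0 : 0 < s := by positivity
  have hsL : s * L < 1 := by
    rw [hs, div_mul_eq_mul_div, div_lt_one (by positivity)]
    linarith [L.2]
  have hs1 : s < 1 := by
    rw [hs, div_lt_one (by positivity)]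
    linarith [L.2]
  have hχc := hχ.continuous
  set R : Space n × unitInterval → Space n := fun p => p.1 + (-(p.2 * s)) • (χ p.1 • p.1) with hR
  refine ⟨1 - s, by linarith, by linarith, chartConj e fun u => R (u, 1),
    isFinalMapOfIsotopy_chartConj hKc hK2 (by fun_prop) (fun t => ?_) (fun u hu t => ?_)
      (fun u => by simp [hR]), fun u hu => ?_⟩
  · have hlip : LipschitzWith (‖-(t * s)‖₊ * L) fun u => (-(t * s)) • (χ u • u) :=
      (lipschitzWith_smul (-(t * s))).comp hL
    refine (IsFinalMapOfIsotopy.add_of_lipschitz hlip ?_).isHomeomorph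
    rw [← NNReal.coe_lt_coe]
    push_cast
    rw [norm_neg, Real.norm_of_nonneg (mul_nonneg t.2.1 hs0.le)]
    refine lt_of_le_of_lt ?_ hsL
    have : (t : ℝ) * s ≤ s := mul_le_of_le_one_left hs0.le t.2.2
    gcongr
  · simp [hR, hχ0 u hu]
  · rw [chartConj_symm_apply _ (hcube hu)]
    simp [hR, hχ1 u hu, sub_smul, ← sub_eq_add_neg]

/-- Coordinatewise truncation to the cube of radius `r`. -/
noncomputable def clamp (r : ℝ) (u : Space n) : Space n :=
  WithLp.toLp 2 fun i => max (-r) (min r (u i))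

theorem lipschitzWith_clamp (r : ℝ) : LipschitzWith 1 (clamp r : Space n → Space n) := by
  refine LipschitzWith.of_dist_le_mul fun u v => ?_
  rw [NNReal.coe_one, one_mul, EuclideanSpace.dist_eq, EuclideanSpace.dist_eq]
  refine Real.sqrt_le_sqrt ?_
  gcongr with i
  have h : LipschitzWith 1 fun x : ℝ => max (-r) (min r x) :=
    (LipschitzWith.id.const_min r).const_max (-r)
  simpa [clamp] using! h.dist_le_mul (u i) (v i)

theorem clamp_of_mem {r : ℝ} {u : Space n} (hu : ∀ i, |u i| ≤ r) : clamp r u = u := by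
  ext i
  have := abs_le.1 (hu i)
  simp [clamp, this.1, this.2]

theorem abs_clamp_le {r : ℝ} (hr : 0 ≤ r) (u : Space n) (i : Fin n) : |clamp r u i| ≤ r := by
  simp only [clamp, abs_le]
  constructor
  · exact le_max_left _ _
  · exact max_le (by linarith) (min_le_left _ _)

/-- Near a point, a map with an invertible strict derivative is undone, up to the derivative, by
the final map of an ambient isotopy. -/
theorem exists_isotopy_linearize {G : Space n → Space n} {A : Space n ≃L[ℝ] Space n}
    (hG : HasStrictFDerivAt G (A : Space n →L[ℝ] Space n) 0) :
    ∃ r > 0, ∃ h, IsFinalMapOfIsotopy h ∧ ∀ u, (∀ i, |u i| ≤ r) → h (G u) = A u := by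
  set a : ℝ≥0 := ‖(A.symm : Space n →L[ℝ] Space n)‖₊
  -- The error G - A is to have Lipschitz constant κ near 0 with κ ‖A⁻¹‖ < 1.
  set κ : ℝ≥0 := (2 * (a + 1))⁻¹ with hκ
  have hκ0 : 0 < κ := by positivity
  have hκa : κ * a < 1 := by
    rw [hκ, inv_mul_lt_iff₀ (by positivity), mul_one, ← NNReal.coe_lt_coe]
    push_cast
    linarith [a.2]
  obtain ⟨s, hs, hsG⟩ := hG.approximates_deriv_on_nhds (c := κ) (Or.inr hκ0)
  obtain ⟨ρ, hρ, hρs⟩ := Metric.mem_nhds_iff.1 hs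
  set r : ℝ := ρ / (2 * (√n + 1)) with hr
  have hr0 : 0 < r := by positivity
  have hmem : ∀ u : Space n, (∀ i, |u i| ≤ r) → u ∈ s := by
    intro u hu
    refine hρs ?_
    rw [mem_ball_zero_iff, EuclideanSpace.norm_eq]
    have h1 : ∑ i, ‖u i‖ ^ 2 ≤ n * r ^ 2 := by
      calc ∑ i, ‖u i‖ ^ 2 ≤ ∑ _i : Fin n, r ^ 2 := by
            gcongr with i
            exact hu i
        _ = n * r ^ 2 := by simp
    calc √(∑ i, ‖u i‖ ^ 2) ≤ √(n * r ^ 2) := Real.sqrt_le_sqrt h1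
      _ = √n * r := by rw [Real.sqrt_mul (by positivity), Real.sqrt_sq hr0.le]
      _ < ρ := by
        rw [hr, mul_div_assoc', div_lt_iff₀ (by positivity)]
        nlinarith [Real.sqrt_nonneg n]
  set f : Space n → Space n := fun u => G u - A u with hf
  have hfl : LipschitzOnWith κ f s :=
    ApproximatesLinearOn.approximatesLinearOn_iff_lipschitzOnWith.1 hsG
  -- Truncation makes the error globally Lipschitz. On small `u`, id + q takes A u to G u, so its
  -- inverse is the required map.
  set q : Space n → Space n := fun w => f (clamp r (A.symm w)) with hq
  have hql : LipschitzWith (κ * a) q := by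
    have h1 : LipschitzOnWith κ f (range (clamp r ∘ A.symm)) :=
      hfl.mono (range_subset_iff.2 fun u => hmem _ (abs_clamp_le hr0.le _))
    have h2 : LipschitzWith (1 * a) (clamp r ∘ A.symm : Space n → Space n) :=
      (lipschitzWith_clamp r).comp (A.symm : Space n →L[ℝ] Space n).lipschitz
    rw [one_mul] at h2
    rw [← lipschitzOnWith_univ]
    exact h1.comp h2.lipschitzOnWith (fun u _ => mem_range_self u)
  obtain ⟨h, hh, hl, -⟩ := (IsFinalMapOfIsotopy.add_of_lipschitz hql hκa).exists_inverse
  refine ⟨r, hr0, h, hh, fun u hu => ?_⟩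
  have h1 : A u + q (A u) = G u := by
    simp only [hq, ContinuousLinearEquiv.symm_apply_apply, clamp_of_mem hu, hf]
    abel
  rw [← h1]
  exact hl _

/-- The inverse chart, restricted to the cube, is undone, up to an invertible linear map, by the
final map of an ambient isotopy. -/
theorem exists_isotopy_chart {e : OpenPartialHomeomorph (Space n) (Space n)}
    (he : ContDiffOn ℝ 1 e e.source) (he' : ContDiffOn ℝ 1 e.symm e.target)
    (hcube : cube n ⊆ e.target) : ∃ A : Space n ≃L[ℝ] Space n, ∃ h, IsFinalMapOfIsotopy h ∧
      ∀ u ∈ cube n, h (e.symm u) = A u := by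
  have h0 : (0 : Space n) ∈ e.target := hcube zero_mem_cube
  have hG : ContDiffAt ℝ 1 e.symm 0 := he'.contDiffAt (e.open_target.mem_nhds h0)
  have hE : ContDiffAt ℝ 1 e (e.symm 0) :=
    he.contDiffAt (e.open_source.mem_nhds (e.map_target h0))
  have hGs := hG.hasStrictFDerivAt one_ne_zero
  have hGd := hGs.hasFDerivAt
  have hEd := (hE.differentiableAt one_ne_zero).hasFDerivAt
  have h1 : (fderiv ℝ e (e.symm 0)).comp (fderiv ℝ e.symm 0) = ContinuousLinearMap.id ℝ _ := by
    refine (hEd.comp 0 hGd).unique ((hasFDerivAt_id 0).congr_of_eventuallyEq ?_)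
    filter_upwards [e.open_target.mem_nhds h0] with u hu
    exact e.right_inv hu
  have h2 : (fderiv ℝ e.symm 0).comp (fderiv ℝ e (e.symm 0)) = ContinuousLinearMap.id ℝ _ := by
    have hGd' : HasFDerivAt e.symm (fderiv ℝ e.symm 0) (e (e.symm 0)) := by rwa [e.right_inv h0]
    refine (hGd'.comp _ hEd).unique ((hasFDerivAt_id _).congr_of_eventuallyEq ?_)
    filter_upwards [e.open_source.mem_nhds (e.map_target h0)] with u hu
    exact e.left_inv hu
  set A : Space n ≃L[ℝ] Space n := ContinuousLinearEquiv.equivOfInverse (fderiv ℝ e.symm 0)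
    (fderiv ℝ e (e.symm 0)) (fun u => congrArg (fun L : _ →L[ℝ] _ => L u) h1)
    (fun u => congrArg (fun L : _ →L[ℝ] _ => L u) h2)
  have hA : HasStrictFDerivAt e.symm (A : Space n →L[ℝ] Space n) 0 := hGs
  obtain ⟨r, hr, h, hh, hhA⟩ := exists_isotopy_linearize hA
  obtain ⟨s, hs0, hs1, g, hg, hgs⟩ := exists_isotopy_shrink hcube
  -- Repeated shrinking brings the cube into the region where the chart can be linearized; the
  -- resulting linear map is s^m A.
  obtain ⟨m, hm⟩ := exists_pow_lt_of_lt_one hr hs1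
  have hiter : ∀ (m : ℕ), ∀ u ∈ cube n, g^[m] (e.symm u) = e.symm (s ^ m • u) := by
    intro m
    induction m with
    | zero => simp
    | succ m ih =>
      intro u hu
      rw [Function.iterate_succ_apply, hgs u hu, ih _ (smul_mem_cube hu hs0.le hs1.le), smul_smul,
        pow_succ]
  have hsm : 0 < s ^ m := pow_pos hs0 m
  refine ⟨(ContinuousLinearEquiv.smulLeft (Units.mk0 (s ^ m) hsm.ne')).trans A, h ∘ g^[m],
    hh.comp (hg.iterate m), fun u hu => ?_⟩
  rw [Function.comp_apply, hiter m u hu, hhA]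
  · rfl
  · intro i
    rw [PiLp.smul_apply, smul_eq_mul, abs_mul, abs_of_pos hsm]
    calc s ^ m * |u i| ≤ s ^ m * 1 := by gcongr; exact hu i
      _ ≤ r := by linarith

end Chart

/-! ### The descending flow in a tube -/

section Tube

variable {n : ℕ} {P : Space n → Space n} {N : Set (Space n)}
  {e : OpenPartialHomeomorph (Space n) (Space n)} {k : Fin n}

namespace IsFlowTube

theorem subset_source (hT : IsFlowTube P N e k) : N ⊆ e.source := by
  rw [hT.eq_image]
  rintro _ ⟨u, hu, rfl⟩
  exact e.map_target (hT.cube_subset hu)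

theorem apply_mem_cube (hT : IsFlowTube P N e k) {x : Space n} (hx : x ∈ N) : e x ∈ cube n := by
  rw [hT.eq_image] at hx
  obtain ⟨u, hu, rfl⟩ := hx
  rwa [e.right_inv (hT.cube_subset hu)]

theorem symm_mem (hT : IsFlowTube P N e k) {u : Space n} (hu : u ∈ cube n) : e.symm u ∈ N := by
  rw [hT.eq_image]
  exact mem_image_of_mem _ hu

theorem isCompact (hT : IsFlowTube P N e k) : IsCompact N := by
  rw [hT.eq_image]
  exact (isCompact_cube n).image_of_continuousOn (e.symm.continuousOn.mono hT.cube_subset)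

theorem continuousOn_coord (hT : IsFlowTube P N e k) (i : Fin n) :
    ContinuousOn (fun x => e x i) N := by
  have h1 : Continuous fun u : Space n => u i := by fun_prop
  exact h1.comp_continuousOn (e.continuousOn.mono hT.subset_source)

theorem isCompact_le (hT : IsFlowTube P N e k) (c : ℝ) : IsCompact {x ∈ N | e x k ≤ c} :=
  hT.isCompact.of_isClosed_subset
    ((hT.continuousOn_coord k).preimage_isClosed_of_isClosed hT.isCompact.isClosed isClosed_Iic)
    (sep_subset _ _)

theorem isCompact_ge (hT : IsFlowTube P N e k) (c : ℝ) : IsCompact {x ∈ N | c ≤ e x k} :=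
  hT.isCompact.of_isClosed_subset
    ((hT.continuousOn_coord k).preimage_isClosed_of_isClosed hT.isCompact.isClosed isClosed_Ici)
    (sep_subset _ _)

theorem hasFDerivAt (hT : IsFlowTube P N e k) {x : Space n} (hx : x ∈ N) :
    HasFDerivAt e (fderiv ℝ e x) x :=
  ((hT.contDiffOn.contDiffAt (e.open_source.mem_nhds (hT.subset_source hx))).differentiableAt
    one_ne_zero).hasFDerivAt

theorem continuousOn_velocity (hT : IsFlowTube P N e k) (hP : Continuous P) :
    ContinuousOn (fun x => fderiv ℝ e x (P x)) N :=
  ((hT.contDiffOn.continuousOn_fderiv_of_isOpen e.open_source le_rfl).mono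
    hT.subset_source).clm_apply hP.continuousOn

/-- Curves that are straight in the chart serve as test curves for Nagumo's theorem. -/
theorem hasDerivAt_symm (hT : IsFlowTube P N e k) {x : Space n} (hx : x ∈ N) (v : Space n) :
    HasDerivAt (fun r : ℝ => e.symm (e x + r • fderiv ℝ e x v)) v 0 := by
  have hs := hT.subset_source hx
  have h1 : HasFDerivAt e.symm (fderiv ℝ e.symm (e x)) (e x) :=
    ((hT.contDiffOn_symm.contDiffAt (e.open_target.mem_nhds (e.map_source hs))).differentiableAt
      one_ne_zero).hasFDerivAt
  have h2 : (fderiv ℝ e.symm (e x)).comp (fderiv ℝ e x) = ContinuousLinearMap.id ℝ _ := by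
    refine (h1.comp x (hT.hasFDerivAt hx)).unique ((hasFDerivAt_id x).congr_of_eventuallyEq ?_)
    filter_upwards [e.open_source.mem_nhds hs] with u hu
    exact e.left_inv hu
  have h3 : HasDerivAt (fun r : ℝ => e x + r • fderiv ℝ e x v) (fderiv ℝ e x v) 0 := by
    simpa using ((hasDerivAt_id (0 : ℝ)).smul_const (fderiv ℝ e x v)).const_add (e x)
  have h4 : HasFDerivAt e.symm (fderiv ℝ e.symm (e x)) (e x + (0 : ℝ) • fderiv ℝ e x v) := by
    simpa using h1
  have h5 := h4.comp_hasDerivAt (0 : ℝ) h3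
  have h6 : fderiv ℝ e.symm (e x) (fderiv ℝ e x v) = v :=
    congrArg (fun L : Space n →L[ℝ] Space n => L v) h2
  rwa [h6] at h5

/-- Near the bottom of the tube the orbits rise. -/
theorem exists_velocity_bound (hT : IsFlowTube P N e k) (hP : Continuous P) :
    ∃ c > -1, ∃ δ > 0, ∀ x ∈ N, e x k ≤ c → δ ≤ fderiv ℝ e x (P x) k := by
  have hw : ContinuousOn (fun x => fderiv ℝ e x (P x) k) N :=
    (by fun_prop : Continuous fun u : Space n => u k).comp_continuousOn (hT.continuousOn_velocity hP)
  obtain ⟨b, hb, hbmin⟩ : ∃ b ∈ {x ∈ N | e x k ≤ -1},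
      IsMinOn (fun x => fderiv ℝ e x (P x) k) {x ∈ N | e x k ≤ -1} b := by
    refine (hT.isCompact_le (-1)).exists_isMinOn ?_ (hw.mono (sep_subset _ _))
    have hu : -EuclideanSpace.single k (1 : ℝ) ∈ cube n := fun i => by
      by_cases h : i = k
      · subst h; simp
      · simp [h]
    refine ⟨e.symm (-EuclideanSpace.single k (1 : ℝ)), hT.symm_mem hu, ?_⟩
    rw [e.right_inv (hT.cube_subset hu)]
    simp
  set δ := fderiv ℝ e b (P b) k with hδ
  have hδ0 : 0 < δ := by
    refine hT.transverse_ends b hb.1 ?_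
    have h1 := (abs_le.1 (hT.apply_mem_cube hb.1 k)).1
    rw [le_antisymm hb.2 h1]; simp
  -- The points with rising speed at most δ/2 form a compact set disjoint from the bottom; `c` is
  -- taken halfway between the bottom and its lowest point.
  have hW : IsCompact {x ∈ N | fderiv ℝ e x (P x) k ≤ δ / 2} :=
    hT.isCompact.of_isClosed_subset
      (hw.preimage_isClosed_of_isClosed hT.isCompact.isClosed isClosed_Iic) (sep_subset _ _)
  rcases {x ∈ N | fderiv ℝ e x (P x) k ≤ δ / 2}.eq_empty_or_nonempty with he | hne
  · refine ⟨0, by norm_num, δ / 2, by positivity, fun x hx _ => ?_⟩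
    by_contra! h
    exact (he ▸ (⟨hx, h.le⟩ : x ∈ {x ∈ N | _}) : x ∈ (∅ : Set _))
  · obtain ⟨z, hz, hzmin⟩ := hW.exists_isMinOn hne ((hT.continuousOn_coord k).mono (sep_subset _ _))
    have h1 : -1 < e z k := by
      by_contra! h
      have h2 : δ ≤ _ := hbmin (⟨hz.1, h⟩ : z ∈ {x ∈ N | e x k ≤ -1})
      linarith [hz.2]
    refine ⟨(-1 + e z k) / 2, by linarith, δ / 2, by positivity, fun x hx hxc => ?_⟩
    by_contra! h
    have h2 : e z k ≤ e x k := hzmin (⟨hx, h.le⟩ : x ∈ {x ∈ N | _})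
    linarith

end IsFlowTube

/-- `Φ` is the flow of `-χ P`, where the factor `χ` vanishes on the bottom of the tube and is
positive on the rest of it. -/
structure IsDescendingFlow (P : Space n → Space n) (N : Set (Space n))
    (e : OpenPartialHomeomorph (Space n) (Space n)) (k : Fin n) (χ : Space n → ℝ)
    (Φ : ℝ → Space n → Space n) : Prop where
  continuous : Continuous χ
  eq_zero : ∀ x ∈ N, e x k = -1 → χ x = 0
  pos : ∀ x ∈ N, -1 < e x k → 0 < χ x
  isFlow : IsFlow (fun x => -(χ x • P x)) Φ
  lipschitz : ∃ K : ℝ≥0, LipschitzWith K fun x => -(χ x • P x)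

/-- Take χ to be the distance to the union of the bottom disc and the exterior of a ball containing
the tube; χP is then bounded and Lipschitz. -/
theorem IsFlowTube.exists_isDescendingFlow (hT : IsFlowTube P N e k) (hP : LocallyLipschitz P) :
    ∃ χ Φ, IsDescendingFlow P N e k χ Φ := by
  obtain ⟨ρ, hρ⟩ := hT.isCompact.isBounded.subset_ball 0
  set Z : Set (Space n) := {x ∈ N | e x k ≤ -1} ∪ (ball 0 ρ)ᶜ with hZ
  have hZc : IsClosed Z := (hT.isCompact_le (-1)).isClosed.union isOpen_ball.isClosed_compl
  have h0 : ∀ x ∈ Z, infDist x Z = 0 := fun x hx => infDist_zero_of_mem hx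
  obtain ⟨K, M, hK, hM⟩ := exists_lipschitzWith_smul hP (lipschitz_infDist_pt Z)
    (isCompact_closedBall 0 ρ) (fun x hx => h0 x (Or.inr fun h => hx (ball_subset_closedBall h)))
  have hK' : LipschitzWith K fun x => -(infDist x Z • P x) := hK.neg
  obtain ⟨Φ, hΦ⟩ := exists_isFlow hK' (M := M) (fun x => by rw [norm_neg]; exact hM x)
  refine ⟨fun x => infDist x Z, Φ, continuous_infDist_pt Z,
    fun x hx h => h0 x (Or.inl ⟨hx, h.le⟩), fun x hx h => ?_, hΦ, K, hK'⟩
  have hne : Z.Nonempty := by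
    have hu : -EuclideanSpace.single k (1 : ℝ) ∈ cube n := fun i => by
      by_cases h : i = k
      · subst h; simp
      · simp [h]
    refine ⟨e.symm (-EuclideanSpace.single k (1 : ℝ)), Or.inl ⟨hT.symm_mem hu, ?_⟩⟩
    rw [e.right_inv (hT.cube_subset hu)]
    simp
  refine (hZc.notMem_iff_infDist_pos hne).1 ?_
  rintro (h1 | h1)
  · exact absurd h1.2 (not_le.2 h)
  · exact h1 (hρ hx)

namespace IsDescendingFlow

variable {χ : Space n → ℝ} {Φ : ℝ → Space n → Space n}

theorem nonneg (hD : IsDescendingFlow P N e k χ Φ) (hT : IsFlowTube P N e k) {x : Space n}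
    (hx : x ∈ N) : 0 ≤ χ x := by
  rcases (abs_le.1 (hT.apply_mem_cube hx k)).1.eq_or_lt with h | h
  · exact (hD.eq_zero x hx h.symm).ge
  · exact (hD.pos x hx h).le

/-- Nagumo's condition holds for -χP on each face: it is tangent to the sides, zero on the bottom,
and does not point upward at the top or at height `c`. -/
theorem mem_le (hD : IsDescendingFlow P N e k χ Φ) (hT : IsFlowTube P N e k) {c : ℝ}
    (hc : ∀ x ∈ N, e x k = c → 0 ≤ fderiv ℝ e x (P x) k) {x : Space n}
    (hx : x ∈ {x ∈ N | e x k ≤ c}) {t : ℝ} (ht : 0 ≤ t) : Φ t x ∈ {x ∈ N | e x k ≤ c} := by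
  obtain ⟨K, hK⟩ := hD.lipschitz
  refine hD.isFlow.mapsTo_of_subtangential hK (hT.isCompact_le c).isClosed (fun y hy => ?_) hx ht
  set v := fderiv ℝ e y (-(χ y • P y)) with hv
  have hvi : ∀ i, v i = -(χ y * fderiv ℝ e y (P y) i) := fun i => by simp [hv]
  have hχ := hD.nonneg hT hy.1
  refine ⟨fun r => e.symm (e y + r • v), by simp [e.left_inv (hT.subset_source hy.1)],
    (hT.hasDerivAt_symm hy.1 _).hasDerivWithinAt, ?_⟩
  -- Strict inequalities persist for short times; at equality the sign of the velocity decides.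
  have hcont : ∀ i, Continuous fun r : ℝ => e y i + r * v i := fun i => by fun_prop
  have hlt : ∀ i a, e y i < a → ∀ᶠ r in 𝓝[>] (0 : ℝ), e y i + r * v i ≤ a := fun i a h => by
    have : ∀ᶠ r in 𝓝 (0 : ℝ), e y i + r * v i < a :=
      (hcont i).continuousAt.eventually (gt_mem_nhds (by simpa using h))
    filter_upwards [this.filter_mono nhdsWithin_le_nhds] with r hr using hr.le
  have hgt : ∀ i a, a < e y i → ∀ᶠ r in 𝓝[>] (0 : ℝ), a ≤ e y i + r * v i := fun i a h => by
    have : ∀ᶠ r in 𝓝 (0 : ℝ), a < e y i + r * v i :=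
      (hcont i).continuousAt.eventually (lt_mem_nhds (by simpa using h))
    filter_upwards [this.filter_mono nhdsWithin_le_nhds] with r hr using hr.le
  have hdown : ∀ a, e y k ≤ a → (e y k = a → 0 ≤ fderiv ℝ e y (P y) k) →
      ∀ᶠ r in 𝓝[>] (0 : ℝ), e y k + r * v k ≤ a := fun a h h' => by
    rcases h.eq_or_lt with h | h
    · filter_upwards [self_mem_nhdsWithin] with r (hr : 0 < r)
      have h1 : 0 ≤ r * (χ y * fderiv ℝ e y (P y) k) :=
        mul_nonneg hr.le (mul_nonneg hχ (h' h))
      rw [hvi]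
      linarith
    · exact hlt k a h
  have habs := hT.apply_mem_cube hy.1
  have hcube : ∀ i, ∀ᶠ r in 𝓝[>] (0 : ℝ), |e y i + r * v i| ≤ 1 := fun i => by
    have hi := abs_le.1 (habs i)
    by_cases hik : i = k
    · subst hik
      have h1 : ∀ᶠ r in 𝓝[>] (0 : ℝ), -1 ≤ e y i + r * v i := by
        rcases hi.1.eq_or_lt with h | h
        · have : v i = 0 := by rw [hvi, hD.eq_zero y hy.1 h.symm]; simp
          simp [this, hi.1]
        · exact hgt i _ h
      have h2 := hdown 1 hi.2 fun h => (hT.transverse_ends y hy.1 (by simp [h])).le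
      filter_upwards [h1, h2] with r h3 h4 using abs_le.2 ⟨h3, h4⟩
    · rcases (habs i).eq_or_lt with h | h
      · have : v i = 0 := by rw [hvi, hT.tangent_sides y hy.1 i hik h]; simp
        simp [this, habs i]
      · have h' := abs_lt.1 h
        filter_upwards [hlt i 1 h'.2, hgt i (-1) h'.1] with r h3 h4 using abs_le.2 ⟨h4, h3⟩
  filter_upwards [eventually_all.2 hcube, hdown c hy.2 (hc y hy.1)] with r h1 h2
  have hmem : e y + r • v ∈ cube n := fun i => by simpa using h1 i
  refine ⟨hT.symm_mem hmem, ?_⟩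
  rw [e.right_inv (hT.cube_subset hmem)]
  simpa using h2

theorem mem_tube (hD : IsDescendingFlow P N e k χ Φ) (hT : IsFlowTube P N e k) {x : Space n}
    (hx : x ∈ N) {t : ℝ} (ht : 0 ≤ t) : Φ t x ∈ N :=
  (hD.mem_le hT (c := 1) (fun y hy h => (hT.transverse_ends y hy (by simp [h])).le)
    ⟨hx, (abs_le.1 (hT.apply_mem_cube hx k)).2⟩ ht).1

theorem apply_of_bottom (hD : IsDescendingFlow P N e k χ Φ) {x : Space n} (hx : x ∈ N)
    (h : e x k = -1) (t : ℝ) : Φ t x = x := by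
  obtain ⟨K, hK⟩ := hD.lipschitz
  have := ODE_solution_unique_univ (v := fun _ x => -(χ x • P x)) (s := fun _ => univ) (t₀ := 0)
    (f := fun r => Φ r x) (g := fun _ => x)
    (fun _ => hK.lipschitzOnWith) (fun r => ⟨hD.isFlow.hasDerivAt x r, mem_univ _⟩)
    (fun r => ⟨by simpa [hD.eq_zero x hx h] using hasDerivAt_const r x, mem_univ _⟩)
    (by simp [hD.isFlow.zero])
  exact congrFun this t

/-- Bottom points are stationary, so by invertibility of the flow no other point reaches them. -/
theorem not_bottom (hD : IsDescendingFlow P N e k χ Φ) (hT : IsFlowTube P N e k) {x : Space n}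
    (hx : x ∈ N) (h : -1 < e x k) {t : ℝ} (ht : 0 ≤ t) : -1 < e (Φ t x) k := by
  obtain ⟨K, hK⟩ := hD.lipschitz
  have hmem := hD.mem_tube hT hx ht
  refine lt_of_le_of_ne (abs_le.1 (hT.apply_mem_cube hmem k)).1 fun h1 => ?_
  have h2 := hD.apply_of_bottom hmem h1.symm (-t)
  rw [hD.isFlow.apply_neg hK] at h2
  rw [← h2] at h1
  exact h.ne h1

/-- If the descending flow keeps a point forever away from the bottom of the tube, in the past and
in the future, then the tube contains a complete orbit. -/
theorem exists_complete_orbit (hD : IsDescendingFlow P N e k χ Φ) (hT : IsFlowTube P N e k)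
    (hP : LocallyLipschitz P) {c : ℝ} (hc : -1 < c) {z : Space n}
    (hz : ∀ t, Φ t z ∈ {x ∈ N | c ≤ e x k}) :
    ∃ β : ℝ → Space n, (∀ t, HasDerivAt β (P (β t)) t) ∧ range β ⊆ N := by
  obtain ⟨K₀, hK₀⟩ := hD.lipschitz
  -- A cutoff equal to 1 on the tube gives a global flow Θ that follows `P` as long as it stays in
  -- the tube.
  have hθ : LipschitzWith 1 fun x => max 0 (1 - infDist x N) := by
    have h1 : LipschitzWith 1 fun x => infDist x N := lipschitz_infDist_pt N
    have h2 : LipschitzWith (0 + 1) fun x => 1 - infDist x N := (LipschitzWith.const 1).sub h1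
    rw [zero_add] at h2
    exact h2.const_max 0
  have hθ1 : ∀ x ∈ N, max 0 (1 - infDist x N) = 1 := fun x hx => by
    simp [infDist_zero_of_mem hx]
  obtain ⟨K, M, hK, hM⟩ := exists_lipschitzWith_smul hP hθ (hT.isCompact.cthickening (r := 1))
    (fun x hx => by
      have hne : N.Nonempty := ⟨_, (hz 0).1⟩
      refine max_eq_left ?_
      by_contra! h
      refine hx (thickening_subset_cthickening _ _ ((mem_thickening_iff_infDist_lt hne).2 ?_))
      linarith)
  obtain ⟨Θ, hΘ⟩ := exists_isFlow hK hM
  have hyc := hD.isFlow.continuous_time z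
  obtain ⟨c₁, hc₁, hχ⟩ : ∃ c₁ > 0, ∀ t, c₁ ≤ χ (Φ t z) := by
    obtain ⟨w, hw, hmin⟩ := (hT.isCompact_ge c).exists_isMinOn ⟨_, hz 0⟩ hD.continuous.continuousOn
    exact ⟨χ w, hD.pos w hw.1 (hc.trans_le hw.2), fun t => hmin (hz t)⟩
  set G : ℝ → ℝ := fun t => ∫ s in (0 : ℝ)..t, -χ (Φ s z) with hG
  have hgc : Continuous fun s => -χ (Φ s z) := (hD.continuous.comp hyc).neg
  have hGd : ∀ t, HasDerivAt G (-χ (Φ t z)) t := fun t =>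
    intervalIntegral.integral_hasDerivAt_right (hgc.intervalIntegrable _ _)
      (hgc.stronglyMeasurableAtFilter _ _) hgc.continuousAt
  have hG0 : G 0 = 0 := by simp [hG]
  have key : ∀ t, Φ t z = Θ (G t) z := by
    intro t
    -- The time change is compared from the left endpoint -|t|, which handles both signs of `t`, and
    -- then rebased at time 0.
    set a : ℝ := -|t| with ha
    obtain ⟨C, hC⟩ := (isCompact_Icc (a := a) (b := |t|)).exists_bound_of_continuousOn
      hgc.continuousOn
    have h1 := hΘ.eq_reparam hK (a := a) (b := |t|) (y := fun s => Φ s z)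
      (g := fun s => -χ (Φ s z)) (G := fun s => G s - G a) (C := C.toNNReal)
      (fun s hs => (hC s hs).trans (Real.le_coe_toNNReal C))
      (fun s _ => ((hGd s).sub_const _).hasDerivWithinAt) (by simp)
      (fun s _ => by
        have := (hD.isFlow.hasDerivAt z s).hasDerivWithinAt (s := Icc a |t|)
        rw [hθ1 _ (hz s).1, one_smul, neg_smul]
        exact this)
    have h2 := h1 0 ⟨by simp [ha], abs_nonneg t⟩
    have h3 := h1 t ⟨neg_abs_le t, le_abs_self t⟩
    simp only [hD.isFlow.zero, hG0] at h2
    calc Φ t z = Θ (G t - G a) (Φ a z) := h3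
      _ = Θ (G t) (Θ (0 - G a) (Φ a z)) := by rw [← hΘ.add hK]; congr 1; ring
      _ = Θ (G t) z := by rw [← h2]
  -- As χ ≥ c₁ along the line, G decreases at rate at least c₁ and is onto ℝ: the reparametrized
  -- line is the whole Θ-orbit.
  have hanti : Antitone fun t => G t + c₁ * t := by
    refine antitone_of_hasDerivAt_nonpos (fun t =>
      (hGd t).add ((hasDerivAt_id t).const_mul c₁)) fun t => ?_
    change -χ (Φ t z) + c₁ * 1 ≤ 0
    linarith [hχ t]
  have hsurj : Function.Surjective G := by
    refine Continuous.surjective' (continuous_iff_continuousAt.2 fun t => (hGd t).continuousAt) ?_ ?_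
    · refine tendsto_atTop_mono' (f₁ := fun t => -c₁ * t) _ ?_
        (tendsto_id.const_mul_atBot_of_neg (neg_neg_of_pos hc₁))
      filter_upwards [eventually_le_atBot 0] with t ht
      have := hanti ht
      simp only [hG0, mul_zero, add_zero] at this
      linarith
    · refine tendsto_atBot_mono' (f₁ := fun t => -c₁ * t) _ ?_
        (tendsto_id.const_mul_atTop_of_neg (neg_neg_of_pos hc₁))
      filter_upwards [eventually_ge_atTop 0] with t ht
      have := hanti ht
      simp only [hG0, mul_zero, add_zero] at this
      linarith
  have hmem : ∀ s, Θ s z ∈ N := fun s => by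
    obtain ⟨t, rfl⟩ := hsurj s
    rw [← key]
    exact (hz t).1
  refine ⟨fun s => Θ s z, fun s => ?_, range_subset_iff.2 hmem⟩
  have := hΘ.hasDerivAt z s
  rwa [hθ1 _ (hmem s), one_smul] at this

/-- If the tube contains no complete orbit, then the descending flow carries the tube in finite
time into a given neighborhood of its bottom. -/
theorem exists_time (hD : IsDescendingFlow P N e k χ Φ) (hT : IsFlowTube P N e k)
    (hP : LocallyLipschitz P) (hN : ∀ S, IsInvariantSubmanifold P S → ¬ S ⊆ N) {c : ℝ}
    (hc : -1 < c) (hup : ∀ x ∈ N, e x k = c → 0 ≤ fderiv ℝ e x (P x) k) :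
    ∃ M : ℝ, 0 ≤ M ∧ ∀ x ∈ N, Φ M x ∈ {x ∈ N | e x k ≤ c} := by
  obtain ⟨K, hK⟩ := hD.lipschitz
  by_contra! hcon
  -- These are the points that stay at or above level `c` for all |t| ≤ m; a point common to all of
  -- them has a complete orbit in the tube.
  set A : ℕ → Set (Space n) := fun m => {z | ∀ t ∈ Icc (-(m : ℝ)) m, Φ t z ∈ {x ∈ N | c ≤ e x k}}
  have hAne : ∀ m, (A m).Nonempty := by
    intro m
    -- A point not yet in the layer at time 2m was never in it before, since the layer is forward
    -- invariant; its image at time m lies in `A m`.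
    obtain ⟨x, hx, hxM⟩ := hcon (m + m) (by positivity)
    refine ⟨Φ m x, fun t ht => ?_⟩
    have ht0 : 0 ≤ t + m := by linarith [ht.1]
    rw [← hD.isFlow.add hK]
    have hmem := hD.mem_tube hT hx ht0
    refine ⟨hmem, ?_⟩
    by_contra! h
    refine hxM ?_
    have h1 := hD.mem_le hT hup ⟨hmem, h.le⟩ (sub_nonneg.2 ht.2)
    rw [← hD.isFlow.add hK] at h1
    convert h1 using 2
    ring
  have hAc : ∀ m, IsClosed (A m) := by
    intro m
    have : A m = ⋂ t ∈ Icc (-(m : ℝ)) m, Φ t ⁻¹' {x ∈ N | c ≤ e x k} := by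
      ext z; simp [A]
    rw [this]
    exact isClosed_biInter fun t _ =>
      (hT.isCompact_ge c).isClosed.preimage (hD.isFlow.isHomeomorph hK t).continuous
  have hAmono : ∀ m, A (m + 1) ⊆ A m := fun m z hz t ht =>
    hz t ⟨by push_cast; linarith [ht.1], by push_cast; linarith [ht.2]⟩
  have hA0 : IsCompact (A 0) := by
    refine (hT.isCompact_ge c).of_isClosed_subset (hAc 0) fun z hz => ?_
    have := hz 0 (by simp)
    rwa [hD.isFlow.zero] at this
  obtain ⟨z, hz⟩ := IsCompact.nonempty_iInter_of_sequence_nonempty_isCompact_isClosed A hAmono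
    hAne hA0 hAc
  rw [mem_iInter] at hz
  obtain ⟨β, hβ, hβN⟩ := hD.exists_complete_orbit hT hP hc (z := z) fun t => by
    obtain ⟨m, hm⟩ := exists_nat_ge |t|
    exact hz m t (abs_le.1 hm)
  exact hN _ (isInvariantSubmanifold_range hP hβ) hβN

/-- Earlier points of an orbit in the tube are reached from later ones by the descending flow. -/
theorem exists_eq_flow (hD : IsDescendingFlow P N e k χ Φ)
    {γ : ℝ → Space n} {a b : ℝ} (hab : a < b) (hγ : IsOrbitIn P N a b γ)
    (hbot : ∀ t ∈ Icc a b, -1 < e (γ t) k) : ∃ s > 0, γ a = Φ s (γ b) := by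
  obtain ⟨K, hK⟩ := hD.lipschitz
  have hγc : ContinuousOn γ (Icc a b) := fun t ht => (hγ.1 t ht).continuousWithinAt
  have hpos : ∀ t ∈ Icc a b, 0 < χ (γ t) := fun t ht => hD.pos _ (hγ.2 ht) (hbot t ht)
  have hgc : ContinuousOn (fun t => (χ (γ t))⁻¹) (Icc a b) :=
    (hD.continuous.comp_continuousOn hγc).inv₀ fun t ht => (hpos t ht).ne'
  set g : ℝ → ℝ := IccExtend hab.le ((Icc a b).domRestrict fun t => (χ (γ t))⁻¹) with hg
  -- Since P = (-1/χ)(-χP), the orbit is the descending flow run backwards, with elapsed time ∫ 1/χ.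
  -- Extending 1/χ beyond [a, b] makes it continuous on ℝ.
  have hgcont : Continuous g := (continuousOn_iff_continuous_domRestrict.1 hgc).Icc_extend'
  have hgeq : ∀ t ∈ Icc a b, g t = (χ (γ t))⁻¹ := fun t ht => by
    rw [hg, IccExtend_of_mem _ _ ht]; rfl
  set G : ℝ → ℝ := fun t => -∫ s in a..t, g s with hG
  have hGd : ∀ t, HasDerivAt G (-g t) t := fun t =>
    (intervalIntegral.integral_hasDerivAt_right (hgcont.intervalIntegrable _ _)
      (hgcont.stronglyMeasurableAtFilter _ _) hgcont.continuousAt).neg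
  obtain ⟨C, hC⟩ := (isCompact_Icc (a := a) (b := b)).exists_bound_of_continuousOn
    hgcont.continuousOn
  have h1 := hD.isFlow.eq_reparam hK (a := a) (b := b) (y := γ) (g := fun t => -g t) (G := G)
    (C := C.toNNReal) (fun t ht => by
      rw [norm_neg]; exact (hC t ht).trans (Real.le_coe_toNNReal C))
    (fun t _ => (hGd t).hasDerivWithinAt) (by simp [hG])
    (fun t ht => by
      rw [hgeq t ht, neg_smul, smul_neg, neg_neg, smul_smul, inv_mul_cancel₀ (hpos t ht).ne',
        one_smul]
      exact hγ.1 t ht) b ⟨hab.le, le_rfl⟩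
  refine ⟨-G b, ?_, ?_⟩
  · rw [hG, neg_neg]
    refine intervalIntegral.intervalIntegral_pos_of_pos_on (hgcont.intervalIntegrable _ _)
      (fun t ht => ?_) hab
    rw [hgeq t (Ioo_subset_Icc_self ht)]
    exact inv_pos.2 (hpos t (Ioo_subset_Icc_self ht))
  · rw [h1, hD.isFlow.apply_neg hK]

end IsDescendingFlow

/-- An orbit in the tube meets the bottom of the tube at most at its initial point. -/
theorem IsFlowTube.not_bottom_of_orbit (hT : IsFlowTube P N e k) {γ : ℝ → Space n} {a b : ℝ}
    (hγ : IsOrbitIn P N a b γ) {t : ℝ} (ht : t ∈ Ioc a b) : -1 < e (γ t) k := by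
  have ht' : t ∈ Icc a b := Ioc_subset_Icc_self ht
  have hcube : ∀ s ∈ Icc a b, -1 ≤ e (γ s) k := fun s hs =>
    (abs_le.1 (hT.apply_mem_cube (hγ.2 hs) k)).1
  refine lt_of_le_of_ne (hcube t ht') fun h => ?_
  have hd : HasDerivWithinAt (fun s => e (γ s) k) (fderiv ℝ e (γ t) (P (γ t)) k) (Icc a b) t :=
    ((EuclideanSpace.proj k : Space n →L[ℝ] ℝ).hasFDerivAt).comp_hasDerivWithinAt t
      ((hT.hasFDerivAt (hγ.2 ht')).comp_hasDerivWithinAt t (hγ.1 t ht'))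
  have hmin : IsLocalMinOn (fun s => e (γ s) k) (Icc a b) t := by
    filter_upwards [self_mem_nhdsWithin] with s hs
    rw [← h]
    exact hcube s hs
  -- At a bottom point the height is minimal, so it cannot have negative slope in the direction of
  -- earlier times; transversality says that it does.
  have h1 := hmin.hasFDerivWithinAt_nonneg hd.hasFDerivWithinAt (y := a - t)
    (sub_mem_posTangentConeAt_of_segment_subset ((convex_Icc a b).segment_subset ht'
      ⟨le_rfl, ht'.1.trans ht'.2⟩))
  have h2 : 0 < fderiv ℝ e (γ t) (P (γ t)) k := hT.transverse_ends _ (hγ.2 ht') (by simp [← h])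
  simp at h1
  nlinarith [ht.1]

end Tube

/-! ### Monotone representations and transition maps -/

section Representation

variable {n : ℕ} {P : Space n → Space n} {N : Set (Space n)}
  {e : OpenPartialHomeomorph (Space n) (Space n)} {k : Fin n}

/-- A continuous function that is strictly increasing away from the left end of an interval is
strictly increasing. -/
theorem strictMonoOn_Icc_of_Ioc {f : ℝ → ℝ} {a b : ℝ} (hf : ContinuousOn f (Icc a b))
    (h : StrictMonoOn f (Ioc a b)) : StrictMonoOn f (Icc a b) := by
  intro s hs t ht hst
  rcases hs.1.eq_or_lt with rfl | has
  · set m := (a + t) / 2 with hm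
    have hma : a < m := by linarith
    have hmt : m < t := by linarith
    have hmb : m ∈ Ioc a b := ⟨hma, hmt.le.trans ht.2⟩
    refine lt_of_le_of_lt ?_ (h hmb ⟨hst, ht.2⟩ hmt)
    have hc : Tendsto f (𝓝[>] a) (𝓝 (f a)) :=
      (hf a hs).tendsto.mono_left (nhdsWithin_le_of_mem (Icc_mem_nhdsGT (hst.trans_le ht.2)))
    refine le_of_tendsto hc ?_
    filter_upwards [Ioo_mem_nhdsGT hma] with r hr
    exact (h ⟨hr.1, hr.2.le.trans hmb.2⟩ hmb hr.2).le
  · exact h ⟨has, hs.2⟩ ⟨has.trans hst, ht.2⟩ hst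

/-- Where the tube coordinate `k` increases at a definite rate, a large multiple of it dominates the
derivative of any given linear functions of the tube coordinates. -/
theorem IsFlowTube.exists_dominating (hT : IsFlowTube P N e k) (hP : Continuous P) {c δ : ℝ}
    (hδ : 0 < δ) (hc : ∀ x ∈ N, e x k ≤ c → δ ≤ fderiv ℝ e x (P x) k)
    (B : Space n →L[ℝ] Space n) {p : Space n} (hp : ∀ i, 0 < p i) :
    ∃ C, 0 ≤ C ∧ ∀ x ∈ N, e x k ≤ c → ∀ i,
      0 < B (fderiv ℝ e x (P x)) i + C * fderiv ℝ e x (P x) k * p i := by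
  obtain ⟨M, hM⟩ := hT.isCompact.exists_bound_of_continuousOn
    (B.continuous.comp_continuousOn (hT.continuousOn_velocity hP))
  -- The sum dominates each term, and the i-th term alone makes C δ p_i ≥ |M| + 1.
  set C : ℝ := ∑ i, (|M| + 1) / (δ * p i) with hC
  have hterm : ∀ i, 0 ≤ (|M| + 1) / (δ * p i) := fun i => by have := hp i; positivity
  refine ⟨C, Finset.sum_nonneg fun i _ => hterm i, fun x hx hxc i => ?_⟩
  have h1 : (|M| + 1) / (δ * p i) ≤ C := Finset.single_le_sum (fun j _ => hterm j)
    (Finset.mem_univ i)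
  have hpi := hp i
  have h2 : |M| + 1 ≤ C * (δ * p i) := (div_le_iff₀ (by positivity)).1 h1
  have h3 : C * (δ * p i) ≤ C * fderiv ℝ e x (P x) k * p i := by
    rw [← mul_assoc]
    have := (hterm i).trans h1
    gcongr
    exact hc x hx hxc
  have h4 : -|M| ≤ B (fderiv ℝ e x (P x)) i := by
    have h5 : |B (fderiv ℝ e x (P x)) i| ≤ ‖B (fderiv ℝ e x (P x))‖ :=
      PiLp.norm_apply_le (B (fderiv ℝ e x (P x))) i
    have h6 := (h5.trans (hM x hx)).trans (le_abs_self M)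
    exact (neg_le_neg h6).trans (neg_abs_le _)
  linarith

/-- In dimension at least two, all coordinates can be made to increase along the orbits in a tube
without invariant submanifolds. -/
theorem IsFlowTube.exists_increasing (hT : IsFlowTube P N e k) (hn : 2 ≤ n)
    (hP : LocallyLipschitz P) (hN : ∀ S, IsInvariantSubmanifold P S → ¬ S ⊆ N) :
    ∃ φ, IsFinalMapOfIsotopy φ ∧ ∀ a b γ, IsOrbitIn P N a b γ →
      ∀ i, StrictMonoOn (fun t => φ (γ t) i) (Icc a b) := by
  obtain ⟨c, hc1, δ, hδ, hc⟩ := hT.exists_velocity_bound hP.continuous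
  obtain ⟨χ, Φ, hD⟩ := hT.exists_isDescendingFlow hP
  obtain ⟨K, hK⟩ := hD.lipschitz
  obtain ⟨M, hM0, hM⟩ := hD.exists_time hT hP hN hc1
    (fun x hx hxc => hδ.le.trans (hc x hx hxc.le))
  obtain ⟨A, h, hh, hA⟩ := exists_isotopy_chart hT.contDiffOn hT.contDiffOn_symm hT.cube_subset
  obtain ⟨B, p, hp, hB⟩ := exists_isotopy_shear hn A k
  obtain ⟨C, hC0, hC⟩ := hT.exists_dominating hP.continuous hδ hc B hp
  obtain ⟨g, hg, hgB⟩ := hB C hC0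
  have hφ : ∀ x ∈ N, g (h x) = B (e x) + (C * e x k) • p := fun x hx => by
    have := hA _ (hT.apply_mem_cube hx)
    rw [e.left_inv (hT.subset_source hx)] at this
    rw [this, hgB]
  have hfin : IsFinalMapOfIsotopy (g ∘ h ∘ Φ M) := hg.comp (hh.comp (.flow hD.isFlow hK M))
  -- Inside the low layer the straightened coordinates are linear in the chart, and each decreases
  -- strictly along the descending flow.
  have hdesc : ∀ x ∈ {x ∈ N | e x k ≤ c}, -1 < e x k → ∀ s > 0, ∀ i,
      g (h (Φ s x)) i < g (h x) i := by
    intro x hx hxk s hs i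
    have hmem : ∀ r, 0 ≤ r → Φ r x ∈ {x ∈ N | e x k ≤ c} := fun r hr =>
      hD.mem_le hT (fun x hx hxc => hδ.le.trans (hc x hx hxc.le)) hx hr
    set L : Space n →L[ℝ] ℝ := (EuclideanSpace.proj i : Space n →L[ℝ] ℝ) ∘L B +
      (C * p i) • (EuclideanSpace.proj k : Space n →L[ℝ] ℝ) with hL
    have hLv : ∀ v, L v = B v i + C * v k * p i := fun v => by simp [hL]; ring
    have hgL : ∀ x ∈ N, g (h x) i = L (e x) := fun x hx => by
      rw [hφ x hx, hLv]; simp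
    have hd : ∀ r, 0 ≤ r → HasDerivAt (fun r => L (e (Φ r x)))
        (L (fderiv ℝ e (Φ r x) (-(χ (Φ r x) • P (Φ r x))))) r := fun r hr =>
      L.hasFDerivAt.comp_hasDerivAt r
        ((hT.hasFDerivAt (hmem r hr).1).comp_hasDerivAt r (hD.isFlow.hasDerivAt x r))
    have hanti : StrictAntiOn (fun r => L (e (Φ r x))) (Ici 0) := by
      refine strictAntiOn_of_hasDerivWithinAt_neg (convex_Ici 0)
        (fun r hr => (hd r hr).continuousAt.continuousWithinAt)
        (fun r hr => (hd r (interior_subset hr)).hasDerivWithinAt) fun r hr => ?_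
      have hr0 : 0 ≤ r := interior_subset hr
      have h1 := hC _ (hmem r hr0).1 (hmem r hr0).2 i
      have h2 := hD.pos _ (hmem r hr0).1 (hD.not_bottom hT hx.1 hxk hr0)
      rw [← hLv] at h1
      simp only [map_neg, map_smul, smul_eq_mul]
      exact neg_neg_of_pos (mul_pos h2 h1)
    have h3 := hanti (mem_Ici.2 le_rfl) (mem_Ici.2 hs.le) hs
    simp only [hD.isFlow.zero] at h3
    rw [hgL _ hx.1, hgL _ (hmem s hs.le).1]
    exact h3
  -- The initial point may lie on the bottom, where the descending flow rests; continuity covers it.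
  refine ⟨_, hfin, fun a b γ hγ i => strictMonoOn_Icc_of_Ioc ?_ fun s hs t ht hst => ?_⟩
  · have h1 : Continuous fun x => (g ∘ h ∘ Φ M) x i :=
      (by fun_prop : Continuous fun u : Space n => u i).comp hfin.isHomeomorph.continuous
    exact h1.comp_continuousOn fun t ht => (hγ.1 t ht).continuousWithinAt
  · have hsub : Icc s t ⊆ Icc a b := Icc_subset_Icc hs.1.le ht.2
    have hγ' : IsOrbitIn P N s t γ := ⟨IsIntegralCurveOn.mono hγ.1 hsub, hγ.2.mono_left hsub⟩
    obtain ⟨r, hr, hsr⟩ := hD.exists_eq_flow hst hγ' fun u hu =>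
      hT.not_bottom_of_orbit hγ ⟨hs.1.trans_le hu.1, hu.2.trans ht.2⟩
    have htN : γ t ∈ N := hγ.2 (Ioc_subset_Icc_self ht)
    -- The time maps Φ_M and Φ_r commute, so γ s = Φ_r(γ t) holds also after sliding both points
    -- into the low layer.
    have h1 := hdesc (Φ M (γ t)) (hM _ htN)
      (hD.not_bottom hT htN (hT.not_bottom_of_orbit hγ ht) hM0) r hr i
    rw [← hD.isFlow.add hK, add_comm, hD.isFlow.add hK, ← hsr] at h1
    exact h1

/-- In dimension one, the vector field has a constant sign on a tube without equilibria. -/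
theorem IsFlowTube.sign_const {P : Space 1 → Space 1} {N : Set (Space 1)}
    {e : OpenPartialHomeomorph (Space 1) (Space 1)} {k : Fin 1} (hT : IsFlowTube P N e k)
    (hP : LocallyLipschitz P) (hN : ∀ S, IsInvariantSubmanifold P S → ¬ S ⊆ N) :
    (∀ x ∈ N, 0 < P x 0) ∨ ∀ x ∈ N, P x 0 < 0 := by
  have hne : ∀ x ∈ N, P x 0 ≠ 0 := by
    intro x hx h
    have hPx : P x = 0 := by
      ext i; rw [Subsingleton.elim i 0]; exact h
    refine hN _ (isInvariantSubmanifold_range (β := fun _ => x) hP fun t => ?_)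
      (range_subset_iff.2 fun _ => hx)
    rw [hPx]
    exact hasDerivAt_const t x
  have hconn : IsPreconnected N := by
    rw [hT.eq_image]
    have hconv : Convex ℝ (cube 1) := by
      have : cube 1 = ⋂ i, {u : Space 1 | u i ∈ Icc (-1 : ℝ) 1} := by
        ext; simp [cube, abs_le]
      rw [this]
      exact convex_iInter fun i => (convex_Icc (-1 : ℝ) 1).linear_preimage
        (EuclideanSpace.proj i : Space 1 →L[ℝ] ℝ).toLinearMap
    exact hconv.isPreconnected.image _ (e.symm.continuousOn.mono hT.cube_subset)
  have hcont : ContinuousOn (fun x => P x 0) N :=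
    ((by fun_prop : Continuous fun u : Space 1 => u 0).comp hP.continuous).continuousOn
  by_contra! hcon
  obtain ⟨⟨x, hx, hx0⟩, y, hy, hy0⟩ := hcon
  obtain ⟨z, hz, hz0⟩ := hconn.intermediate_value hx hy hcont ⟨hx0, hy0⟩
  exact hne z hz hz0

theorem isMonotoneRepresentation_id {P : Space 1 → Space 1} {N : Set (Space 1)}
    (h : (∀ x ∈ N, 0 < P x 0) ∨ ∀ x ∈ N, P x 0 < 0) : IsMonotoneRepresentation P N id := by
  have hd : ∀ {a b : ℝ} {γ : ℝ → Space 1}, IsOrbitIn P N a b γ → ∀ t ∈ Icc a b,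
      HasDerivWithinAt (fun t => γ t 0) (P (γ t) 0) (Icc a b) t := fun hγ t ht =>
    ((EuclideanSpace.proj 0 : Space 1 →L[ℝ] ℝ).hasFDerivAt).comp_hasDerivWithinAt t (hγ.1 t ht)
  refine ⟨IsHomeomorph.id, fun i => ?_⟩
  rw [Subsingleton.elim i 0]
  rcases h with h | h
  · refine Or.inl fun a b γ hγ => strictMonoOn_of_hasDerivWithinAt_pos (convex_Icc a b)
      (fun t ht => (hd hγ t ht).continuousWithinAt)
      (fun t ht => (hd hγ t (interior_subset ht)).mono interior_subset)
      fun t ht => h _ (hγ.2 (interior_subset ht))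
  · refine Or.inr fun a b γ hγ => strictAntiOn_of_hasDerivWithinAt_neg (convex_Icc a b)
      (fun t ht => (hd hγ t ht).continuousWithinAt)
      (fun t ht => (hd hγ t (interior_subset ht)).mono interior_subset)
      fun t ht => h _ (hγ.2 (interior_subset ht))

theorem exists_transition {φ₁ φ₂ : Space n → Space n} (h₁ : IsHomeomorph φ₁)
    (h₂ : IsHomeomorph φ₂) (A : Set (Space n)) : ∃ Ψ, IsTransition A φ₁ φ₂ Ψ := by
  refine ⟨φ₂ ∘ h₁.homeomorph.symm, h₂.comp h₁.homeomorph.symm.isHomeomorph, fun x _ => ?_⟩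
  have : h₁.homeomorph.symm (φ₁ x) = x := h₁.homeomorph.symm_apply_apply x
  simp [this]

theorem IsOrbitIn.mono {A A' : Set (Space n)} (h : A ⊆ A') {a b : ℝ} {γ : ℝ → Space n}
    (hγ : IsOrbitIn P A a b γ) : IsOrbitIn P A' a b γ :=
  ⟨hγ.1, hγ.2.mono_right h⟩

theorem IsTransition.eqOn_orbit {A : Set (Space n)} {φ₁ φ₂ Ψ : Space n → Space n}
    (hΨ : IsTransition A φ₁ φ₂ Ψ) {a b : ℝ} {γ : ℝ → Space n} (hγ : IsOrbitIn P A a b γ)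
    (i : Fin n) : EqOn (fun t => φ₂ (γ t) i) (fun t => Ψ (φ₁ (γ t)) i) (Icc a b) := fun t ht => by
  simp only [hΨ.2 _ (hγ.2 ht)]

/-- On orbits in the intersection Ψ ∘ φ₁ is φ₂, every entry of which is monotone. -/
theorem IsTransition.preservesMonotonicity {N₁ N₂ : Set (Space n)} {φ₁ φ₂ Ψ : Space n → Space n}
    (hΨ : IsTransition (N₁ ∩ N₂) φ₁ φ₂ Ψ) (h₂ : IsMonotoneRepresentation P N₂ φ₂) :
    PreservesMonotonicity P (N₁ ∩ N₂) φ₁ Ψ := by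
  intro a b γ hγ i _
  have hγ₂ := hγ.mono inter_subset_right
  have heq := hΨ.eqOn_orbit hγ i
  exact (h₂.monotone i).imp (fun h => (h a b γ hγ₂).congr heq) fun h => (h a b γ hγ₂).congr heq

theorem preservesSense_id (A : Set (Space n)) (φ : Space n → Space n) : PreservesSense P A φ id :=
  fun _ _ _ _ _ => ⟨fun h => h, fun h => h⟩

/-- A transition between two coordinate systems in which all coordinates increase preserves the
sense of monotonicity. -/
theorem IsTransition.preservesSense {N₁ N₂ : Set (Space n)} {φ₁ φ₂ Ψ : Space n → Space n}
    (hΨ : IsTransition (N₁ ∩ N₂) φ₁ φ₂ Ψ)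
    (h₁ : ∀ a b γ, IsOrbitIn P N₁ a b γ → ∀ i, StrictMonoOn (fun t => φ₁ (γ t) i) (Icc a b))
    (h₂ : ∀ a b γ, IsOrbitIn P N₂ a b γ → ∀ i, StrictMonoOn (fun t => φ₂ (γ t) i) (Icc a b)) :
    PreservesSense P (N₁ ∩ N₂) φ₁ Ψ := by
  intro a b γ hγ i
  refine ⟨fun _ => (h₂ a b γ (hγ.mono inter_subset_right) i).congr (hΨ.eqOn_orbit hγ i),
    fun h s hs t ht hst => ?_⟩
  exact absurd (h hs ht hst) (h₁ a b γ (hγ.mono inter_subset_left) i hs ht hst).not_gt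

end Representation

end Foliation

/-! ### The Foliation Theorem -/

theorem mainTheorem4 {n : ℕ} (P : Foliation.Space n → Foliation.Space n)
    (hP : LocallyLipschitz P) :
    (∀ (N : Set (Foliation.Space n)) (T : ℝ) (γ : ℝ → Foliation.Space n),
      Foliation.IsAdmissible P N T γ →
        ∃ φ, Foliation.IsFinalMapOfIsotopy φ ∧ Foliation.IsMonotoneRepresentation P N φ) ∧
    (∀ (N₁ N₂ : Set (Foliation.Space n)) (T₁ T₂ : ℝ) (γ₁ γ₂ : ℝ → Foliation.Space n),
      Foliation.IsAdmissible P N₁ T₁ γ₁ → Foliation.IsAdmissible P N₂ T₂ γ₂ →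
      (N₁ ∩ N₂).Nonempty →
        (∀ φ₁ φ₂, Foliation.IsMonotoneRepresentation P N₁ φ₁ →
          Foliation.IsMonotoneRepresentation P N₂ φ₂ →
            ∃ Ψ, Foliation.IsTransition (N₁ ∩ N₂) φ₁ φ₂ Ψ ∧
              Foliation.PreservesMonotonicity P (N₁ ∩ N₂) φ₁ Ψ) ∧
        (∃ φ₁ φ₂, Foliation.IsFinalMapOfIsotopy φ₁ ∧ Foliation.IsMonotoneRepresentation P N₁ φ₁ ∧
          Foliation.IsFinalMapOfIsotopy φ₂ ∧ Foliation.IsMonotoneRepresentation P N₂ φ₂ ∧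
            ∃ Ψ, Foliation.IsTransition (N₁ ∩ N₂) φ₁ φ₂ Ψ ∧
              Foliation.PreservesSense P (N₁ ∩ N₂) φ₁ Ψ)) := by
  open Foliation in
  refine ⟨fun N T γ hN => ?_, fun N₁ N₂ T₁ T₂ γ₁ γ₂ hN₁ hN₂ _ =>
    ⟨fun φ₁ φ₂ h₁ h₂ => ?_, ?_⟩⟩
  · obtain ⟨-, ⟨-, e, k, hT⟩, hinv⟩ := hN
    rcases Nat.lt_or_ge n 2 with hn | hn
    · obtain rfl : n = 1 := by have := k.pos; omega
      exact ⟨id, .id, isMonotoneRepresentation_id (hT.sign_const hP hinv)⟩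
    · obtain ⟨φ, hφ, hmono⟩ := hT.exists_increasing hn hP hinv
      exact ⟨φ, hφ, hφ.isHomeomorph, fun i => Or.inl fun a b γ hγ => hmono a b γ hγ i⟩
  · obtain ⟨Ψ, hΨ⟩ := exists_transition h₁.isHomeomorph h₂.isHomeomorph (N₁ ∩ N₂)
    exact ⟨Ψ, hΨ, hΨ.preservesMonotonicity h₂⟩
  · obtain ⟨-, ⟨-, e₁, k₁, hT₁⟩, hinv₁⟩ := hN₁
    obtain ⟨-, ⟨-, e₂, k₂, hT₂⟩, hinv₂⟩ := hN₂
    rcases Nat.lt_or_ge n 2 with hn | hn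
    · obtain rfl : n = 1 := by have := k₁.pos; omega
      -- With the identity for both representations and for Ψ, the signs of `P` on the two tubes
      -- need not be compared.
      exact ⟨id, id, .id, isMonotoneRepresentation_id (hT₁.sign_const hP hinv₁), .id,
        isMonotoneRepresentation_id (hT₂.sign_const hP hinv₂), id,
        ⟨IsHomeomorph.id, fun _ _ => rfl⟩, preservesSense_id _ _⟩
    · obtain ⟨φ₁, hφ₁, hmono₁⟩ := hT₁.exists_increasing hn hP hinv₁
      obtain ⟨φ₂, hφ₂, hmono₂⟩ := hT₂.exists_increasing hn hP hinv₂
      obtain ⟨Ψ, hΨ⟩ := exists_transition hφ₁.isHomeomorph hφ₂.isHomeomorph (N₁ ∩ N₂)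
      exact ⟨φ₁, φ₂, hφ₁,
        ⟨hφ₁.isHomeomorph, fun i => Or.inl fun a b γ hγ => hmono₁ a b γ hγ i⟩, hφ₂,
        ⟨hφ₂.isHomeomorph, fun i => Or.inl fun a b γ hγ => hmono₂ a b γ hγ i⟩, Ψ, hΨ,
        hΨ.preservesSense hmono₁ hmono₂⟩
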